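/- All graphs are finite and simple. For a positive integer $k$, a $k$-packing coloring of a graph $G$ is a map $c:V(G)\to\{1,\dots,k\}$ such that any two distinct vertices $x,y$ with $c(x)=c(y)=i$ satisfy $d_G(x,y)>i$ (vertices in different components are at infinite distance). The packing chromatic number $\chi_\rho(G)$ is the least $k$ for which $G$ has a $k$-packing coloring. The graph $G$ is $4$-$\chi_\rho$-vertex-critical if $\chi_\rho(G)=4$ and $\chi_\rho(G-x)<\chi_\rho(G)$ for every vertex $x$ of $G$. Subdividing an edge $ab$ $l$ times means replacing it by a path $a,a_1,\dots,a_l,b$ with $l$ new vertices (for $l=0$ nothing changes). A vertex is non-pendant if its degree is greater than $1$. $K_n$, $P_n$, $C_n$ denote the complete graph, the path and the cycle on $n$ vertices. Define five families of graphs (up to isomorphism): - $\mathcal F_1$: take the disjoint union of two copies of $K_3$, add an edge joining a vertex of one to a vertex of the other, and subdivide this edge $4k$, $4k+1$ or $4k+2$ times, where $k\ge 0$. - $\mathcal F_2$: take the disjoint union of $K_3$ and $P_3$, join a vertex $u$ of $K_3$ to a non-pendant vertex $v$ of $P_3$, and subdivide the edge $uv$ either $4k+2$ times, where $k\ge 0$,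 or $0$ times. - $\mathcal F_3$: take the disjoint union of $A\in\{P_4,C_4\}$ and $K_3$, join a non-pendant vertex $u$ of $A$ to a vertex $v$ of $K_3$, and subdivide the edge $uv$ $4k$ times, where $k\ge 1$. - $\mathcal F_4$: take the disjoint union of two copies $A,B$ of $P_3$ and one copy $C$ of $P_2$ with vertices $v,v_1$; join a non-pendant vertex $u$ of $A$ to $v$, and join $v$ to a non-pendant vertex $z$ of $B$. Subdivide $uv$ $l=4k+2$ times and $vz$ $l'=4k'$ times, where $k,k'\ge 0$, so that these edges become paths $u,y_1,\dots,y_l,v$ and $v,w_1,\dots,w_{l'},z$. Finally, optionally add exactly one of the edges $v_1y_{l-1}$ and $v_1w_2$ (the latter only if $l'>0$). - $\mathcal F_5$: take the disjoint union of $A,B\in\{P_4,C_4\}$, join a non-pendant vertex $u$ of $A$ to a non-pendant vertex $v$ of $B$, and subdivide the edge $uv$ $2k$ times, where $k\ge 0$. **Theorem.** Every graph $G\in\mathcal F_1\cup\mathcal F_2\cup\mathcal F_3\cup\mathcal F_4\cup\mathcal F_5$ is $4$-$\chi_\rho$-vertex-critical. -/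

import Mathlib

namespace PackingColoring

open SimpleGraph

universe u v

variable {V : Type u} {W : Type v}

/-- `c` is a `k`-packing coloring of `G`: colors lie in `{1, …, k}`, and two distinct vertices of the
same color `i` are at distance greater than `i` (vertices in different components are at infinite
distance). -/
def IsPackingColoring (G : SimpleGraph V) (k : ℕ) (c : V → ℕ) : Prop :=
  (∀ x, 1 ≤ c x ∧ c x ≤ k) ∧ ∀ x y, x ≠ y → c x = c y → (c x : ℕ∞) < G.edist x y

/-- `G` has a `k`-packing coloring. -/
def PackingColorable (G : SimpleGraph V) (k : ℕ) : Prop :=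
  ∃ c : V → ℕ, IsPackingColoring G k c

/-- The packing chromatic number: the least `k` such that `G` has a `k`-packing coloring
(`⊤` if there is none, which does not happen for finite graphs). -/
noncomputable def packingChromaticNumber (G : SimpleGraph V) : ℕ∞ :=
  ⨅ k ∈ {k : ℕ | PackingColorable G k}, (k : ℕ∞)

/-- `G` is packing chromatic vertex-critical: deleting any vertex lowers the packing chromatic
number. -/
def IsPackingVertexCritical (G : SimpleGraph V) : Prop :=
  ∀ x : V, packingChromaticNumber (G.induce {x}ᶜ) < packingChromaticNumber G

/-- `G` is packing chromatic vertex-critical with packing chromatic number `k`. -/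
def IsKPackingVertexCritical (k : ℕ) (G : SimpleGraph V) : Prop :=
  packingChromaticNumber G = k ∧ IsPackingVertexCritical G

/-- A vertex of degree greater than one. -/
def IsNonPendant (G : SimpleGraph V) (x : V) : Prop :=
  1 < (G.neighborSet x).encard

/-- The sequence `a, a₁, …, a_k, b` of vertices replacing an edge `ab` that is subdivided `k` times;
the new vertex `a_j` is `Sum.inr (j - 1)`. -/
def subdivisionPath (a b : V) (k : ℕ) : ℕ → V ⊕ Fin k
  | 0 => Sum.inl a
  | i + 1 => if h : i < k then Sum.inr ⟨i, h⟩ else Sum.inl b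

/-- The subdivision of the edge `ab` of `G`, `k` times: the edge `ab` is removed, and `k` new vertices
together with the `k + 1` edges `aa₁, a₁a₂, …, a_k b` are added. -/
def subdivide (G : SimpleGraph V) (a b : V) (k : ℕ) : SimpleGraph (V ⊕ Fin k) :=
  (G.deleteEdges {s(a, b)}).map Function.Embedding.inl ⊔
    fromEdgeSet {e | ∃ i ≤ k, e = s(subdivisionPath a b k i, subdivisionPath a b k (i + 1))}

/-- The disjoint union of `A` and `B` with the edge `xy` added (`x` in `A`, `y` in `B`) and then
subdivided `l` times. -/
def link (A : SimpleGraph V) (x : V) (B : SimpleGraph W) (y : W) (l : ℕ) :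
    SimpleGraph ((V ⊕ W) ⊕ Fin l) :=
  subdivide ((A ⊕g B) ⊔ edge (Sum.inl x) (Sum.inr y)) (Sum.inl x) (Sum.inr y) l

/-- The triangle `K₃`. -/
abbrev K3 : SimpleGraph (Fin 3) := completeGraph (Fin 3)

/-- The family `F₁`: two triangles joined by an edge that is subdivided `4k`, `4k+1` or `4k+2`
times. -/
def FamilyF1 (G : SimpleGraph V) : Prop :=
  ∃ (x y : Fin 3) (k l : ℕ), (l = 4 * k ∨ l = 4 * k + 1 ∨ l = 4 * k + 2) ∧
    Nonempty (G ≃g link K3 x K3 y l)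

/-- The family `F₂`: a triangle and a path `P₃`, a vertex of the triangle being joined to a
non-pendant vertex of the path by an edge that is subdivided `4k+2` times or not at all. -/
def FamilyF2 (G : SimpleGraph V) : Prop :=
  ∃ (x y : Fin 3) (l : ℕ), IsNonPendant (pathGraph 3) y ∧ (l = 0 ∨ ∃ k : ℕ, l = 4 * k + 2) ∧
    Nonempty (G ≃g link K3 x (pathGraph 3) y l)

/-- The family `F₃`: a path `P₄` or a cycle `C₄`, and a triangle, a non-pendant vertex of the former
being joined to a vertex of the triangle by an edge that is subdivided `4k` times, `k ≥ 1`. -/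
def FamilyF3 (G : SimpleGraph V) : Prop :=
  ∃ A : SimpleGraph (Fin 4), (A = pathGraph 4 ∨ A = cycleGraph 4) ∧
    ∃ (x : Fin 4) (y : Fin 3) (k : ℕ), IsNonPendant A x ∧ 1 ≤ k ∧
      Nonempty (G ≃g link A x K3 y (4 * k))

/-- The disjoint union of two paths `P₃` (called `A` and `B`) and a path `P₂` (called `C`), with edges
`xv` and `vz` added, where `x` is in `A`, `v` in `C` and `z` in `B`. -/
def baseF4 (x : Fin 3) (v : Fin 2) (z : Fin 3) : SimpleGraph ((Fin 3 ⊕ Fin 2) ⊕ Fin 3) :=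
  ((pathGraph 3 ⊕g pathGraph 2) ⊕g pathGraph 3) ⊔
    edge (Sum.inl (Sum.inl x)) (Sum.inl (Sum.inr v)) ⊔
    edge (Sum.inl (Sum.inr v)) (Sum.inr z)

/-- `baseF4` with the edge `xv` subdivided `l` times and the edge `vz` subdivided `m` times. The new
vertices `y₁, …, y_l` on the way from `x` to `v` are `Sum.inl (Sum.inr (j - 1))`, and the new vertices
`w₁, …, w_m` on the way from `v` to `z` are `Sum.inr (j - 1)`. -/
def treeF4 (x : Fin 3) (v : Fin 2) (z : Fin 3) (l m : ℕ) :
    SimpleGraph ((((Fin 3 ⊕ Fin 2) ⊕ Fin 3) ⊕ Fin l) ⊕ Fin m) :=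
  subdivide (subdivide (baseF4 x v z) (Sum.inl (Sum.inl x)) (Sum.inl (Sum.inr v)) l)
    (Sum.inl (Sum.inl (Sum.inr v))) (Sum.inl (Sum.inr z)) m

/-- The family `F₄`: the graphs `treeF4` with `x`, `z` non-pendant, `l = 4k + 2` and `m = 4k'`, to which
at most one of the edges `v₁y_{l-1}` and (if `w₂` exists) `v₁w₂` may be added, where `v₁` is the vertex
of the path `P₂` other than `v`. -/
def FamilyF4 (G : SimpleGraph V) : Prop :=
  ∃ (x z : Fin 3) (v v₁ : Fin 2) (k k' l m : ℕ),
    IsNonPendant (pathGraph 3) x ∧ IsNonPendant (pathGraph 3) z ∧ v₁ ≠ v ∧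
    l = 4 * k + 2 ∧ m = 4 * k' ∧
    (Nonempty (G ≃g treeF4 x v z l m) ∨
      (∃ j : Fin l, (j : ℕ) + 1 = l - 1 ∧
        Nonempty (G ≃g treeF4 x v z l m ⊔
          edge (Sum.inl (Sum.inl (Sum.inl (Sum.inr v₁)))) (Sum.inl (Sum.inr j)))) ∨
      (∃ j : Fin m, (j : ℕ) + 1 = 2 ∧
        Nonempty (G ≃g treeF4 x v z l m ⊔
          edge (Sum.inl (Sum.inl (Sum.inl (Sum.inr v₁)))) (Sum.inr j))))

/-- The family `F₅`: two graphs, each a path `P₄` or a cycle `C₄`, a non-pendant vertex of the one being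
joined to a non-pendant vertex of the other by an edge that is subdivided `2k` times. -/
def FamilyF5 (G : SimpleGraph V) : Prop :=
  ∃ A B : SimpleGraph (Fin 4), (A = pathGraph 4 ∨ A = cycleGraph 4) ∧
    (B = pathGraph 4 ∨ B = cycleGraph 4) ∧
    ∃ (x y : Fin 4) (k : ℕ), IsNonPendant A x ∧ IsNonPendant B y ∧
      Nonempty (G ≃g link A x B y (2 * k))

end PackingColoring

/-!
Every graph in the five families consists of a few small pieces joined by paths, and its vertices
can be numbered so that adjacent numbers differ by at most two. Such a numbered graph is encoded
by a *word*: a list with one letter for each vertex, which tells whether the vertex is adjacent to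
the next vertex and to the one after that. A long path is a repeated letter. A coloring of the
vertices turns a word into a *colored word*.

The packing condition for the colors `1`, `2`, `3` concerns walks of length at most three only, so
it can be checked on the windows of seven consecutive indices (`valid_iff_sound`). This has two
consequences.

* A block of four path vertices can be pumped: if a colored word stays valid when the block is
  repeated at most twice, it stays valid for any number of repetitions (`valid_pump`). Hence
  finitely many explicit colorings, in which the paths carry the periodic pattern `1, 2, 1, 3`,
  handle all path lengths. They show that the graph has a coloring by four colors that uses the
  color `4` once, and one by three colors after the deletion of a vertex outside the paths. The
  deletion of a vertex inside a path leaves two pieces, which are colored independently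
  (`valid_cut`).
* The possible first six cells of a valid colored word form a finite set, which a new letter
  changes in a computable way (`run`). Along a path, this set stays within a finite set that is
  invariant under blocks of four letters (`Reaches.pump`), and at the last end it becomes empty
  (`Reaches.notColorable`). So the graphs have no packing coloring by three colors.

A supergraph of a graph without a coloring has none either, and a coloring restricts to subgraphs.
Therefore `critical_of_words` only asks that the graph lie between the graphs of two words: the
smaller one is tested for the absence of colorings, the larger one for their existence after a
deletion. In this way `P₄` and `C₄` are treated together, and so are the graphs of the fourth
family with and without an additional edge at `v₁`.
-/

namespace PackingColoring

open SimpleGraph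

/-! ### Words and colored words -/

/-- A letter of a word. A word `w` encodes a graph on the indices `0, …, w.length - 1`: the two bits
of the letter at index `i` say whether `i` is adjacent to `i + 1` and to `i + 2`. -/
abbrev Letter := Bool × Bool

/-- A letter together with a color; the color `0` marks a deleted vertex. -/
abbrev Cell := Letter × ℕ

/-- Adjacency of two indices in the graph encoded by a word. -/
def wadj (w : List Letter) (i j : ℕ) : Bool :=
  (j == i + 1 && (w.getD i (false, false)).1) || (j == i + 2 && (w.getD i (false, false)).2) ||
  (i == j + 1 && (w.getD j (false, false)).1) || (i == j + 2 && (w.getD j (false, false)).2)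

/-- The color at an index of a colored word, and `0` outside the word. -/
def col (L : List Cell) (i : ℕ) : ℕ := (L.getD i ((false, false), 0)).2

/-- Adjacency of two indices of a colored word, in the graph without the deleted vertices. -/
def cadj (L : List Cell) (i j : ℕ) : Bool :=
  ((j == i + 1 && (L.getD i ((false, false), 0)).1.1) ||
    (j == i + 2 && (L.getD i ((false, false), 0)).1.2) ||
    (i == j + 1 && (L.getD j ((false, false), 0)).1.1) ||
    (i == j + 2 && (L.getD j ((false, false), 0)).1.2)) && (col L i != 0 && col L j != 0)

/-- The neighbors of an index in a colored word. -/
def nbrs (L : List Cell) (i : ℕ) : List ℕ :=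
  [i + 1, i + 2, i - 1, i - 2].filter (cadj L i)

/-- No walk of length at most three that starts with a step from `i` to `j` violates the packing
condition for the colors `1`, `2`, `3`. -/
def okStep (L : List Cell) (i j : ℕ) : Bool :=
  col L i != col L j &&
    (col L i == 1 || (nbrs L j).all fun k => k == i || ((col L i != col L k || col L i != 2) &&
      (col L i != 3 || (col L k != 3 && (nbrs L k).all fun m => m == i || col L m != 3))))

/-- No walk of length at most three through the index `0` violates the packing condition for the
colors `1`, `2`, `3`. After a reversal, such a walk has `0` as its first or its second vertex. -/
def ok (L : List Cell) : Bool :=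
  (nbrs L 0).all fun j => okStep L 0 j && okStep L j 0

/-- Every window of seven consecutive indices of the colored word passes the test `ok`. -/
def valid : List Cell → Bool
  | [] => true
  | c :: L => ok ((c :: L).take 7) && valid L

/-- The packing condition for the colors `1`, `2`, `3`, for all walks of length at most three of a
colored word. -/
def Sound (L : List Cell) : Prop :=
  ∀ i j, cadj L i j → col L i ≠ col L j ∧ ∀ k, cadj L j k → k ≠ i →
    (col L i = 2 → col L k ≠ 2) ∧ (col L i = 3 → col L k ≠ 3 ∧
      ∀ m, cadj L k m → m ≠ i → col L m ≠ 3)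

theorem mem_nbrs {L : List Cell} {i j : ℕ} : j ∈ nbrs L i ↔ cadj L i j := by
  simp only [nbrs, List.mem_filter, List.mem_cons, List.not_mem_nil, or_false,
    and_iff_right_iff_imp]
  intro h
  simp only [cadj, Bool.and_eq_true, Bool.or_eq_true, beq_iff_eq] at h
  omega

theorem cadj_symm {L : List Cell} {i j : ℕ} (h : cadj L i j) : cadj L j i := by
  simp only [cadj, Bool.and_eq_true, Bool.or_eq_true, beq_iff_eq] at h ⊢
  tauto

theorem cadj_dist {L : List Cell} {i j : ℕ} (h : cadj L i j) :
    i ≤ j + 2 ∧ j ≤ i + 2 := by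
  simp only [cadj, Bool.and_eq_true, Bool.or_eq_true, beq_iff_eq] at h
  omega

theorem cadj_col {L : List Cell} {i j : ℕ} (h : cadj L i j) : col L i ≠ 0 := by
  simp only [cadj, Bool.and_eq_true, bne_iff_ne] at h
  exact h.2.1

theorem col_eq_zero {L : List Cell} {i : ℕ} (h : L.length ≤ i) : col L i = 0 := by
  simp [col, List.getElem?_eq_none h]

theorem okStep_iff {L : List Cell} {i j : ℕ} : okStep L i j ↔ col L i ≠ col L j ∧
    ∀ k, cadj L j k → k ≠ i → (col L i = 2 → col L k ≠ 2) ∧ (col L i = 3 → col L k ≠ 3 ∧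
      ∀ m, cadj L k m → m ≠ i → col L m ≠ 3) := by
  simp only [okStep, List.all_eq_true, mem_nbrs, Bool.and_eq_true, Bool.or_eq_true, bne_iff_ne,
    beq_iff_eq]
  refine and_congr Iff.rfl ?_
  constructor
  · rintro h k hk hki
    rcases h with h | h
    · exact ⟨fun h2 => by omega, fun h3 => by omega⟩
    · obtain ⟨h2, h3⟩ := (h k hk).resolve_left hki
      refine ⟨fun h => ?_, fun h => ?_⟩
      · rcases h2 with h2 | h2 <;> omega
      · obtain ⟨h4, h5⟩ := h3.resolve_left (by simpa using h)
        exact ⟨h4, fun m hm hmi => (h5 m hm).resolve_left hmi⟩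
  · intro h
    right
    intro k hk
    by_cases hki : k = i
    · exact Or.inl hki
    right
    obtain ⟨h2, h3⟩ := h k hk hki
    refine ⟨?_, ?_⟩
    · by_cases hc : col L i = 2
      · exact Or.inl (by rw [hc]; exact (h2 hc).symm)
      · exact Or.inr hc
    · by_cases hc : col L i = 3
      · obtain ⟨h4, h5⟩ := h3 hc
        exact Or.inr ⟨h4, fun m hm => or_iff_not_imp_left.2 (h5 m hm)⟩
      · exact Or.inl hc

theorem ok_iff {L : List Cell} : ok L ↔ ∀ j, cadj L 0 j → okStep L 0 j ∧ okStep L j 0 := by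
  simp only [ok, List.all_eq_true, mem_nbrs, Bool.and_eq_true]

theorem getD_window (L : List Cell) (m i : ℕ) (d : Cell) :
    ((L.drop m).take 7).getD i d = if i < 7 then L.getD (m + i) d else d := by
  simp only [List.getD_eq_getElem?_getD, List.getElem?_take, List.getElem?_drop]
  split_ifs <;> rfl

theorem col_window (L : List Cell) (m i : ℕ) :
    col ((L.drop m).take 7) i = if i < 7 then col L (m + i) else 0 := by
  simp only [col, getD_window]
  split_ifs <;> rfl

theorem cadj_window (L : List Cell) (m i j : ℕ) :
    cadj ((L.drop m).take 7) i j = (decide (i < 7 ∧ j < 7) && cadj L (m + i) (m + j)) := by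
  have e1 : (m + j == m + i + 1) = (j == i + 1) := by
    rw [Bool.eq_iff_iff]; simp; omega
  have e2 : (m + j == m + i + 2) = (j == i + 2) := by
    rw [Bool.eq_iff_iff]; simp; omega
  have e3 : (m + i == m + j + 1) = (i == j + 1) := by
    rw [Bool.eq_iff_iff]; simp; omega
  have e4 : (m + i == m + j + 2) = (i == j + 2) := by
    rw [Bool.eq_iff_iff]; simp; omega
  simp only [cadj, col_window, getD_window, e1, e2, e3, e4]
  by_cases hi : i < 7 <;> by_cases hj : j < 7 <;> simp [hi, hj]

theorem valid_iff_ok {L : List Cell} : valid L ↔ ∀ m, ok ((L.drop m).take 7) := by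
  induction L with
  | nil => simp [valid, ok, nbrs, cadj, col]
  | cons c L ih =>
    simp only [valid, Bool.and_eq_true, ih]
    constructor
    · rintro ⟨h1, h2⟩ (_ | m)
      · exact h1
      · exact h2 m
    · exact fun h => ⟨h 0, fun m => h (m + 1)⟩

/-- A step of a walk changes the index by at most two, so the window of length seven that starts at
the smallest index of a walk of length three contains the walk. -/
theorem valid_iff_sound {L : List Cell} : valid L ↔ Sound L := by
  rw [valid_iff_ok]
  constructor
  · intro h
    -- the walks whose smallest index is the first or the second one
    have key : ∀ n i j, cadj L i j → (i = n ∧ n ≤ j ∨ j = n ∧ n ≤ i) →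
        col L i ≠ col L j ∧ ∀ k, n ≤ k → cadj L j k → k ≠ i →
          (col L i = 2 → col L k ≠ 2) ∧ (col L i = 3 → col L k ≠ 3 ∧
            ∀ m, n ≤ m → cadj L k m → m ≠ i → col L m ≠ 3) := by
      intro n i j hij hn
      have d1 := cadj_dist hij
      obtain ⟨i, rfl⟩ := Nat.exists_eq_add_of_le (by omega : n ≤ i)
      obtain ⟨j, rfl⟩ := Nat.exists_eq_add_of_le (by omega : n ≤ j)
      have h2 : i < 7 := by omega
      have h3 : j < 7 := by omega
      have hw : cadj ((L.drop n).take 7) i j := by simp [cadj_window, h2, h3, hij]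
      have hok : okStep ((L.drop n).take 7) i j := by
        by_cases hi : i = 0
        · subst hi
          exact (ok_iff.1 (h n) j hw).1
        · obtain rfl : j = 0 := by omega
          exact (ok_iff.1 (h n) i (cadj_symm hw)).2
      rw [okStep_iff] at hok
      simp only [col_window, h2, h3, if_true] at hok
      refine ⟨hok.1, fun k hk hjk hki => ?_⟩
      have d2 := cadj_dist hjk
      obtain ⟨k, rfl⟩ := Nat.exists_eq_add_of_le hk
      have h5 : k < 7 := by omega
      obtain ⟨t2, t3⟩ := hok.2 k (by simp [cadj_window, h3, h5, hjk]) (by omega)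
      simp only [h5, if_true] at t2 t3
      refine ⟨t2, fun hc => ⟨(t3 hc).1, fun m hm hkm hmi => ?_⟩⟩
      have d3 := cadj_dist hkm
      obtain ⟨m, rfl⟩ := Nat.exists_eq_add_of_le hm
      have h6 : m < 7 := by omega
      have := (t3 hc).2 m (by simp [cadj_window, h5, h6, hkm]) (by omega)
      simpa [h6] using this
    intro i j hij
    refine ⟨(key (min i j) i j hij (by omega)).1, fun k hjk hki => ?_⟩
    have t : (col L i = 2 → col L k ≠ 2) ∧ (col L i = 3 → col L k ≠ 3) := by
      by_cases hk : min i j ≤ k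
      · have t := (key (min i j) i j hij (by omega)).2 k hk hjk hki
        exact ⟨t.1, fun hc => (t.2 hc).1⟩
      · have t := (key k k j (cadj_symm hjk) (by omega)).2 i (by omega) (cadj_symm hij)
          (Ne.symm hki)
        exact ⟨fun h1 h2 => t.1 h2 h1, fun h1 h2 => (t.2 h2).1 h1⟩
    refine ⟨t.1, fun hc => ⟨t.2 hc, fun m hkm hmi hm => ?_⟩⟩
    by_cases hn : min i j ≤ min k m
    · exact (((key (min i j) i j hij (by omega)).2 k (by omega) hjk hki).2 hc).2 m (by omega) hkm
        hmi hm
    · by_cases hmj : j = m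
      · subst hmj
        exact (key (min i j) i j hij (by omega)).1 (by omega)
      · exact (((key (min k m) m k (cadj_symm hkm) (by omega)).2 j (by omega) (cadj_symm hjk)
          hmj).2 hm).2 i (by omega) (cadj_symm hij) (Ne.symm hmi) hc
  · intro h n
    rw [ok_iff]
    have key : ∀ i j, cadj ((L.drop n).take 7) i j → okStep ((L.drop n).take 7) i j := by
      intro i j hij
      rw [okStep_iff]
      simp only [cadj_window, Bool.and_eq_true, decide_eq_true_eq] at hij ⊢
      obtain ⟨⟨hi, hj⟩, hij⟩ := hij
      simp only [col_window, hi, hj, if_true]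
      obtain ⟨t1, t2⟩ := h _ _ hij
      refine ⟨t1, ?_⟩
      rintro k ⟨⟨-, hk⟩, hjk⟩ hki
      obtain ⟨t3, t4⟩ := t2 _ hjk (by omega)
      simp only [hk, if_true]
      refine ⟨t3, fun hc => ⟨(t4 hc).1, ?_⟩⟩
      rintro m ⟨⟨-, hm⟩, hkm⟩ hmi
      simp only [hm, if_true]
      exact (t4 hc).2 _ hkm (by omega)
    exact fun j hj => ⟨key 0 j hj, key j 0 (cadj_symm hj)⟩

/-! ### Gluing and pumping colored words -/

theorem valid_of_append {x y : List Cell} (h : valid (x ++ y)) : valid y := by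
  induction x with
  | nil => exact h
  | cons c x ih =>
    simp only [List.cons_append, valid, Bool.and_eq_true] at h
    exact ih h.2

/-- Two valid colored words that overlap in at least six cells can be glued. -/
theorem valid_glue {x y z t : List Cell} (hy : 6 ≤ y.length) (h : valid (x ++ y ++ z))
    (h' : valid (y ++ t)) : valid (x ++ y ++ t) := by
  induction x with
  | nil => exact h'
  | cons c x ih =>
    simp only [List.cons_append, valid, Bool.and_eq_true] at h ⊢
    refine ⟨?_, ih h.2⟩
    have key : ∀ s, (c :: (x ++ y ++ s)).take 7 = (c :: (x ++ y)).take 7 := by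
      intro s
      rw [← List.cons_append, List.take_append_of_le_length]
      simp; omega
    rw [key] at h ⊢
    exact h.1

/-- The `k`-fold concatenation of a list with itself. -/
def rep {α : Type*} (k : ℕ) (m : List α) : List α := (List.replicate k m).flatten

@[simp] theorem rep_zero {α : Type*} (m : List α) : rep 0 m = [] := rfl

theorem rep_succ {α : Type*} (k : ℕ) (m : List α) : rep (k + 1) m = m ++ rep k m := rfl

theorem map_rep {α β : Type*} (f : α → β) (k : ℕ) (m : List α) :
    (rep k m).map f = rep k (m.map f) := by
  induction k with
  | zero => rfl
  | succ k ih => simp [rep_succ, ih]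

theorem mem_of_mem_rep {α : Type*} {k : ℕ} {m : List α} {a : α} (h : a ∈ rep k m) : a ∈ m := by
  simp only [rep, List.mem_flatten, List.mem_replicate] at h
  obtain ⟨l, ⟨-, rfl⟩, h⟩ := h
  exact h

theorem length_rep {α : Type*} (k : ℕ) (m : List α) : (rep k m).length = k * m.length := by
  simp [rep]

theorem replicate_mul_add {α : Type*} (k r : ℕ) (a : α) :
    List.replicate (4 * k + r) a = rep k (List.replicate 4 a) ++ List.replicate r a := by
  rw [rep, List.flatten_replicate_replicate, ← List.replicate_add, mul_comm]

/-- Validity for up to two copies of a block of four cells implies validity for any number of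
copies, if the block itself can be repeated. -/
theorem valid_pump {x m z : List Cell} (hm : m.length = 4) (h3 : valid (rep 3 m))
    (h : ∀ k < 3, valid (x ++ (rep k m ++ z))) (k : ℕ) : valid (x ++ (rep k m ++ z)) := by
  have e : ∀ k, rep (k + 2) m ++ z = (m ++ m) ++ (rep k m ++ z) := by
    intro k
    simp [rep_succ]
  have hmm : 6 ≤ (m ++ m).length := by simp [hm]
  have h2 : valid (x ++ (m ++ m) ++ z) := by
    simpa [rep_succ] using h 2 (by omega)
  have key : ∀ k, valid (rep (k + 2) m ++ z) := by
    intro k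
    induction k with
    | zero => exact valid_of_append (h 2 (by omega))
    | succ k ih =>
      rw [e] at ih
      have := valid_glue (x := m) (y := m ++ m) (z := []) hmm (by simpa [rep_succ] using h3) ih
      simpa [rep_succ] using this
  match k with
  | 0 => exact h 0 (by omega)
  | 1 => exact h 1 (by omega)
  | k + 2 =>
    have hk := key k
    rw [e] at hk ⊢
    rw [← List.append_assoc]
    exact valid_glue hmm h2 hk

theorem getD_append {α : Type*} (x y : List α) (i : ℕ) (d : α) :
    (x ++ y).getD i d = if i < x.length then x.getD i d else y.getD (i - x.length) d := by
  split_ifs with h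
  · exact List.getD_append _ _ _ _ h
  · exact List.getD_append_right _ _ _ _ (by omega)

theorem col_append (x y : List Cell) (i : ℕ) :
    col (x ++ y) i = if i < x.length then col x i else col y (i - x.length) := by
  simp only [col, getD_append]
  split_ifs <;> rfl

/-- A deleted vertex separates two valid colored words, if the vertex before it is not adjacent to
the vertex after it. -/
theorem valid_cut {x z : List Cell} {e : Letter} (hx : valid x) (hz : valid z)
    (h : (x.getD (x.length - 1) ((false, false), 0)).1.2 = false) :
    valid (x ++ ((e, 0) :: z)) := by
  rw [valid_iff_sound] at hx hz ⊢
  set L := x ++ ((e, 0) :: z) with hL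
  have hc : ∀ i, col L i = if i < x.length then col x i else
      if i = x.length then 0 else col z (i - x.length - 1) := by
    intro i
    rw [hL, col_append]
    split_ifs with h1 h2
    · rfl
    · simp [h2, col]
    · obtain ⟨n, hn⟩ : ∃ n, i - x.length = n + 1 := ⟨i - x.length - 1, by omega⟩
      simp [hn, col]
  have hg : ∀ i, i ≠ x.length → L.getD i ((false, false), 0) = if i < x.length then
      x.getD i ((false, false), 0) else z.getD (i - x.length - 1) ((false, false), 0) := by
    intro i hi
    rw [hL, getD_append]
    split_ifs with h1
    · rfl
    · obtain ⟨n, hn⟩ : ∃ n, i - x.length = n + 1 := ⟨i - x.length - 1, by omega⟩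
      simp [hn]
  have key1 : ∀ i j, i < x.length → cadj L i j → j < x.length ∧ cadj x i j := by
    intro i j hi hij
    have hj : j < x.length := by
      by_contra hj
      have hjx : j ≠ x.length := by
        rintro rfl
        have := cadj_col (cadj_symm hij)
        simp [hc] at this
      have := cadj_dist hij
      have e1 : i = x.length - 1 := by omega
      have e2 : j = x.length + 1 := by omega
      simp only [cadj, Bool.and_eq_true, Bool.or_eq_true, beq_iff_eq, hg i (by omega), hi,
        if_true] at hij
      rw [e1, h] at hij
      simp at hij
      omega
    refine ⟨hj, ?_⟩
    have l3 : i ≠ x.length := by omega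
    have l4 : j ≠ x.length := by omega
    simp only [cadj, hg i l3, hg j l4, hc, hi, hj, if_true] at hij
    simpa only [cadj] using hij
  have key2 : ∀ i j, x.length < i → cadj L i j → x.length < j ∧
      cadj z (i - x.length - 1) (j - x.length - 1) := by
    intro i j hi hij
    have hj : x.length < j := by
      rcases lt_trichotomy j x.length with hj | hj | hj
      · have := (key1 j i hj (cadj_symm hij)).1
        omega
      · have := cadj_col (cadj_symm hij)
        simp [hc, hj] at this
      · exact hj
    refine ⟨hj, ?_⟩
    have e1 : (j - x.length - 1 == i - x.length - 1 + 1) = (j == i + 1) := by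
      rw [Bool.eq_iff_iff]; simp; omega
    have e2 : (j - x.length - 1 == i - x.length - 1 + 2) = (j == i + 2) := by
      rw [Bool.eq_iff_iff]; simp; omega
    have e3 : (i - x.length - 1 == j - x.length - 1 + 1) = (i == j + 1) := by
      rw [Bool.eq_iff_iff]; simp; omega
    have e4 : (i - x.length - 1 == j - x.length - 1 + 2) = (i == j + 2) := by
      rw [Bool.eq_iff_iff]; simp; omega
    have l1 : ¬ i < x.length := by omega
    have l2 : ¬ j < x.length := by omega
    have l3 : i ≠ x.length := by omega
    have l4 : j ≠ x.length := by omega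
    simp only [cadj, hg i l3, hg j l4, hc, l1, l2, l3, l4, if_false] at hij
    simpa only [cadj, e1, e2, e3, e4] using hij
  intro i j hij
  rcases lt_trichotomy i x.length with hi | hi | hi
  · obtain ⟨hj, h1⟩ := key1 i j hi hij
    obtain ⟨t1, t2⟩ := hx _ _ h1
    simp only [hc i, hc j, hi, hj, if_true]
    refine ⟨t1, fun k hjk hki => ?_⟩
    obtain ⟨hk, h2⟩ := key1 j k hj hjk
    obtain ⟨t3, t4⟩ := t2 k h2 hki
    simp only [hc k, hk, if_true]
    refine ⟨t3, fun hh => ⟨(t4 hh).1, fun m hkm hmi => ?_⟩⟩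
    obtain ⟨hm, h3⟩ := key1 k m hk hkm
    simp only [hc m, hm, if_true]
    exact (t4 hh).2 m h3 hmi
  · exact absurd (by simp [hc, hi]) (cadj_col hij)
  · obtain ⟨hj, h1⟩ := key2 i j hi hij
    obtain ⟨t1, t2⟩ := hz _ _ h1
    have f : ∀ {n}, x.length < n → col L n = col z (n - x.length - 1) := by
      intro n hn
      rw [hc, if_neg (by omega), if_neg (by omega)]
    rw [f hi, f hj]
    refine ⟨t1, fun k hjk hki => ?_⟩
    obtain ⟨hk, h2⟩ := key2 j k hj hjk
    obtain ⟨t3, t4⟩ := t2 _ h2 (by omega)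
    rw [f hk]
    refine ⟨t3, fun hh => ⟨(t4 hh).1, fun m hkm hmi => ?_⟩⟩
    obtain ⟨hm, h3⟩ := key2 k m hk hkm
    rw [f hm]
    exact (t4 hh).2 _ h3 (by omega)

/-! ### The reachable windows -/

/-- The windows of six cells that arise by putting a new first cell with letter `a` and a color in
`{1, 2, 3}` before the windows in `S`. -/
def step (a : Letter) (S : List (List Cell)) : List (List Cell) :=
  ((S.flatMap fun s => ([1, 2, 3].map fun c => (a, c) :: s).filter ok).map (List.take 6)).eraseDups

/-- The windows reached from those in `S` by putting the word `w` in front. -/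
def run (w : List Letter) (S : List (List Cell)) : List (List Cell) := w.foldr step S

/-- A cell whose color is `1`, `2` or `3`. -/
def Proper (c : Cell) : Prop := 1 ≤ c.2 ∧ c.2 ≤ 3

instance : DecidablePred Proper := fun c => inferInstanceAs (Decidable (1 ≤ c.2 ∧ c.2 ≤ 3))

/-- The window of seven cells that begins with a new cell depends on the six cells after it only. -/
theorem take_mem_run {S : List (List Cell)} {x z : List Cell} (hx : ∀ c ∈ x, Proper c)
    (hv : valid (x ++ z)) (hz : z.take 6 ∈ S) : (x ++ z).take 6 ∈ run (x.map Prod.fst) S := by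
  induction x with
  | nil => exact hz
  | cons c x ih =>
    simp only [List.cons_append, valid, Bool.and_eq_true] at hv
    have ih := ih (fun c hc => hx c (List.mem_cons_of_mem _ hc)) hv.2
    have hp := hx c List.mem_cons_self
    simp only [run, List.map_cons, List.foldr_cons, step, List.mem_eraseDups]
    refine List.mem_map.2 ⟨c :: (x ++ z).take 6, List.mem_flatMap.2 ⟨_, ih,
      List.mem_filter.2 ⟨?_, hv.1⟩⟩, ?_⟩
    · obtain ⟨a, b⟩ := c
      obtain ⟨h1, h2⟩ := hp
      have : b = 1 ∨ b = 2 ∨ b = 3 := by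
        simp only at h1 h2
        omega
      simpa using this
    · simp [List.take_take]

theorem take_mem_run_rep {T : List (List Cell)} {m : List Letter}
    (hT : ∀ s ∈ run m T, s ∈ T) (k : ℕ) {x z : List Cell} (hx : ∀ c ∈ x, Proper c)
    (hw : x.map Prod.fst = rep k m)
    (hv : valid (x ++ z)) (hz : z.take 6 ∈ T) : (x ++ z).take 6 ∈ T := by
  induction k generalizing x with
  | zero =>
    simp only [rep_zero, List.map_eq_nil_iff] at hw
    simpa [hw] using hz
  | succ k ih =>
    rw [rep_succ, List.map_eq_append_iff] at hw
    obtain ⟨y, t, rfl, rfl, h2⟩ := hw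
    rw [List.append_assoc] at hv ⊢
    apply hT
    exact take_mem_run (fun c hc => hx c (by simp [hc])) hv
      (ih (fun c hc => hx c (by simp [hc])) h2 (valid_of_append hv))

/-! ### From words to graphs -/

/-- The windows in `S` and those reached from them by at most `n` copies of the word `m`. -/
def orbit (m : List Letter) (S : List (List Cell)) : ℕ → List (List Cell)
  | 0 => S
  | n + 1 => (orbit m S n ++ run m (orbit m S n)).eraseDups

theorem mem_orbit {m : List Letter} {S : List (List Cell)} {s : List Cell} (hs : s ∈ S) (n : ℕ) :
    s ∈ orbit m S n := by
  induction n with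
  | zero => exact hs
  | succ n ih => exact List.mem_eraseDups.2 (List.mem_append_left _ ih)

/-- The encoded graph has no packing coloring with the colors `1`, `2`, `3`. -/
def NotColorable (w : List Letter) : Prop :=
  ∀ L : List Cell, L.map Prod.fst = w → (∀ c ∈ L, Proper c) → ¬ valid L

/-- The encoded graph has a packing coloring with the colors `1`, `2`, `3` after the deletion of the
vertex `i`. -/
def ColorableOff (w : List Letter) (i : ℕ) : Prop :=
  ∃ L : List Cell, L.map Prod.fst = w ∧ valid L ∧ ∀ j < w.length, j ≠ i → 1 ≤ col L j ∧ col L j ≤ 3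

/-- The encoded graph has a packing coloring with the colors `1`, `2`, `3`, `4` such that only the
vertex `0` has the color `4`. -/
def ColorableFour (w : List Letter) : Prop :=
  ∃ L : List Cell, L.map Prod.fst = w ∧ valid L ∧ col L 0 = 4 ∧
    ∀ j < w.length, j ≠ 0 → 1 ≤ col L j ∧ col L j ≤ 3

theorem cadj_iff {L : List Cell} {i j : ℕ} :
    cadj L i j ↔ wadj (L.map Prod.fst) i j ∧ col L i ≠ 0 ∧ col L j ≠ 0 := by
  have h : ∀ i, (L.map Prod.fst).getD i (false, false) = (L.getD i ((false, false), 0)).1 := by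
    intro i
    rw [show ((false, false) : Letter) = Prod.fst (((false, false), 0) : Cell) from rfl,
      List.getD_map]
  simp only [cadj, wadj, h, Bool.and_eq_true, bne_iff_ne]

section Criterion

variable {U : Type*}

theorem exists_walk_of_edist_le {H : SimpleGraph U} {x y : U} {n : ℕ} (h : H.edist x y ≤ n) :
    ∃ p : H.Walk x y, p.length ≤ n := by
  have ht : H.edist x y ≠ ⊤ := fun e => by simp [e] at h
  obtain ⟨p, hp⟩ := exists_walk_of_edist_ne_top ht
  exact ⟨p, by rw [← hp] at h; exact_mod_cast h⟩

/-- A map to a valid colored word pulls the coloring back to a packing coloring; a color above `3`,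
which `valid` does not test, may be used once only. -/
theorem isPackingColoring_of_valid {H : SimpleGraph U} {L : List Cell} (hL : valid L) {k : ℕ}
    {φ : U → ℕ} (hφ : Function.Injective φ) (hadj : ∀ p q, H.Adj p q → cadj L (φ p) (φ q))
    (hc : ∀ p, 1 ≤ col L (φ p) ∧ col L (φ p) ≤ k)
    (h4 : ∀ p q, col L (φ p) = col L (φ q) → 4 ≤ col L (φ p) → p = q) :
    IsPackingColoring H k fun p => col L (φ p) := by
  refine ⟨hc, fun x y hxy hcol => ?_⟩
  simp only at hcol ⊢
  rw [valid_iff_sound] at hL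
  by_contra hlt
  obtain ⟨p, hp⟩ := exists_walk_of_edist_le (not_lt.1 hlt)
  have h3 : col L (φ x) ≤ 3 := by
    by_contra h
    exact hxy (h4 x y hcol (by omega))
  have hne : φ y ≠ φ x := fun h => hxy (hφ h).symm
  match p with
  | .nil => exact hxy rfl
  | .cons h1 .nil => exact (hL _ _ (hadj _ _ h1)).1 hcol
  | .cons h1 (.cons h2 .nil) =>
    obtain ⟨t2, t3⟩ := (hL _ _ (hadj _ _ h1)).2 _ (hadj _ _ h2) hne
    simp only [Walk.length_cons, Walk.length_nil] at hp
    have : col L (φ x) = 2 ∨ col L (φ x) = 3 := by omega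
    rcases this with h | h
    · exact t2 h (by omega)
    · exact (t3 h).1 (by omega)
  | .cons (v := a) h1 (.cons (v := b) h2 (.cons h3' .nil)) =>
    simp only [Walk.length_cons, Walk.length_nil] at hp
    have h : col L (φ x) = 3 := by omega
    by_cases hb : φ b = φ x
    · exact (hL _ _ (hadj _ _ h3')).1 (by rw [hb, hcol])
    · exact (((hL _ _ (hadj _ _ h1)).2 _ (hadj _ _ h2) hb).2 h).2 _ (hadj _ _ h3') hne (by omega)
  | .cons h1 (.cons h2 (.cons h3' (.cons h4' p))) =>
    simp only [Walk.length_cons] at hp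
    omega

/-- A packing coloring by three colors makes a word whose graph lies in `H` a valid colored word. -/
theorem sound_of_isPackingColoring {H : SimpleGraph U} {c : U → ℕ} (hc : IsPackingColoring H 3 c)
    {L : List Cell} {ψ : ℕ → U} (hψ : ∀ i j, i < L.length → j < L.length → ψ i = ψ j → i = j)
    (hcol : ∀ i < L.length, col L i = c (ψ i)) (hadj : ∀ i j, cadj L i j → H.Adj (ψ i) (ψ j)) :
    Sound L := by
  have hlt : ∀ {i j}, cadj L i j → i < L.length := by
    intro i j h
    by_contra hi
    exact cadj_col h (col_eq_zero (by omega))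
  have key : ∀ {i j}, i < L.length → j < L.length → i ≠ j →
      ∀ p : H.Walk (ψ i) (ψ j), col L i = col L j → col L i < p.length := by
    intro i j hi hj hij p h
    have h' := hc.2 (ψ i) (ψ j) (fun e => hij (hψ i j hi hj e))
      (by rw [← hcol i hi, ← hcol j hj, h])
    rw [← hcol i hi] at h'
    exact_mod_cast h'.trans_le p.edist_le
  intro i j hij
  have hi := hlt hij
  have hj := hlt (cadj_symm hij)
  have h1 := hadj i j hij
  refine ⟨fun h => ?_, fun k hjk hki => ?_⟩
  · have ne : i ≠ j := by
      rintro rfl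
      exact h1.ne rfl
    have := key hi hj ne (.cons h1 .nil) h
    have := cadj_col hij
    simp only [Walk.length_cons, Walk.length_nil] at *
    omega
  · have hk := hlt (cadj_symm hjk)
    have h2 := hadj j k hjk
    have t := key hi hk (Ne.symm hki) (.cons h1 (.cons h2 .nil))
    simp only [Walk.length_cons, Walk.length_nil] at t
    refine ⟨fun hh hh' => ?_, fun hh => ⟨fun hh' => ?_, fun m hkm hmi hh' => ?_⟩⟩
    · have := t (by omega)
      omega
    · have := t (by omega)
      omega
    · have hm := hlt (cadj_symm hkm)
      have := key hi hm (Ne.symm hmi) (.cons h1 (.cons h2 (.cons (hadj k m hkm) .nil))) (by omega)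
      simp only [Walk.length_cons, Walk.length_nil] at this
      omega

theorem PackingColorable.mono {H : SimpleGraph U} {k l : ℕ} (hkl : k ≤ l)
    (h : PackingColorable H k) : PackingColorable H l := by
  obtain ⟨c, h1, h2⟩ := h
  exact ⟨c, fun x => ⟨(h1 x).1, (h1 x).2.trans hkl⟩, h2⟩

theorem packingChromaticNumber_le {H : SimpleGraph U} {k : ℕ} (h : PackingColorable H k) :
    packingChromaticNumber H ≤ k :=
  iInf₂_le k h

theorem isKPackingVertexCritical_four {G : SimpleGraph U} (h3 : ¬ PackingColorable G 3)
    (h4 : PackingColorable G 4) (hdel : ∀ x : U, PackingColorable (G.induce {x}ᶜ) 3) :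
    IsKPackingVertexCritical 4 G := by
  have h : packingChromaticNumber G = (4 : ℕ) := by
    refine le_antisymm (packingChromaticNumber_le h4) (le_iInf₂ fun k hk => ?_)
    by_contra hlt
    have hk4 : k < 4 := by exact_mod_cast not_le.1 hlt
    exact h3 (PackingColorable.mono (by omega) hk)
  refine ⟨h, fun x => (packingChromaticNumber_le (hdel x)).trans_lt ?_⟩
  rw [h]
  exact_mod_cast (by norm_num : 3 < 4)

/-- A graph between the graphs of two words, the smaller one without a packing coloring by three
colors, the larger one with such colorings after the deletion of any vertex, is `4`-critical. -/
theorem critical_of_words {U' : Type*} {G : SimpleGraph U'} {H : SimpleGraph U} (f : G ≃g H)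
    {w₀ w₁ : List Letter} {φ₀ φ₁ : U → ℕ} (surj₀ : ∀ i < w₀.length, ∃ v, φ₀ v = i)
    (h₀ : ∀ p q, wadj w₀ (φ₀ p) (φ₀ q) → H.Adj p q) (hno : NotColorable w₀)
    (inj₁ : Function.Injective φ₁) (lt₁ : ∀ v, φ₁ v < w₁.length)
    (h₁ : ∀ p q, H.Adj p q → wadj w₁ (φ₁ p) (φ₁ q))
    (hdel : ∀ i < w₁.length, ColorableOff w₁ i) (h4 : ColorableFour w₁) :
    IsKPackingVertexCritical 4 G := by
  have inj : Function.Injective fun p => φ₁ (f p) := inj₁.comp f.injective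
  have hadj : ∀ p q, G.Adj p q → wadj w₁ (φ₁ (f p)) (φ₁ (f q)) :=
    fun p q h => h₁ _ _ (f.map_adj_iff.2 h)
  apply isKPackingVertexCritical_four
  · rintro ⟨c, hc⟩
    choose ψ hψ using surj₀
    let L : List Cell := List.ofFn fun i : Fin w₀.length => (w₀[i], c (f.symm (ψ i i.2)))
    have hlen : L.length = w₀.length := by simp [L]
    have hcol : ∀ i (hi : i < w₀.length), col L i = c (f.symm (ψ i hi)) := by
      intro i hi
      simp [L, col, hi]
    have hfst : L.map Prod.fst = w₀ := by
      apply List.ext_getElem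
      · simp [hlen]
      · intro i h1 h2
        simp [L]
    refine hno L hfst ?_ ?_
    · intro x hx
      simp only [L, List.mem_ofFn] at hx
      obtain ⟨i, rfl⟩ := hx
      exact hc.1 _
    · rw [valid_iff_sound]
      have hne : ∀ {i}, col L i ≠ 0 → i < w₀.length := by
        intro i h
        by_contra hi
        exact h (col_eq_zero (by omega))
      rcases isEmpty_or_nonempty U' with hU | ⟨⟨u⟩⟩
      · intro i j hij
        exact (hU.false (f.symm (ψ i (hne (cadj_col hij))))).elim
      refine sound_of_isPackingColoring hc
        (ψ := fun i => if hi : i < w₀.length then f.symm (ψ i hi) else u) ?_ ?_ ?_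
      · intro i j hi hj h
        rw [hlen] at hi hj
        simp only [hi, hj, dif_pos] at h
        rw [← hψ i hi, ← hψ j hj, f.symm.injective h]
      · intro i hi
        rw [hlen] at hi
        simp only [hi, dif_pos, hcol]
      · intro i j hij
        obtain ⟨h1, h2, h3⟩ := cadj_iff.1 hij
        rw [hfst] at h1
        simp only [hne h2, hne h3, dif_pos]
        apply f.symm.map_adj_iff.2
        apply h₀
        rw [hψ, hψ]
        exact h1
  · obtain ⟨L, rfl, hv, h0, hL⟩ := h4
    refine ⟨_, isPackingColoring_of_valid hv inj (fun p q h => ?_) (fun p => ?_)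
      fun p q h h' => inj ?_⟩
    · refine cadj_iff.2 ⟨hadj p q h, ?_, ?_⟩
      · by_cases e : φ₁ (f p) = 0
        · simp [e, h0]
        · have := hL _ (lt₁ (f p)) e
          omega
      · by_cases e : φ₁ (f q) = 0
        · simp [e, h0]
        · have := hL _ (lt₁ (f q)) e
          omega
    · by_cases e : φ₁ (f p) = 0
      · simp [e, h0]
      · have := hL _ (lt₁ (f p)) e
        omega
    · have key : ∀ p, 4 ≤ col L (φ₁ (f p)) → φ₁ (f p) = 0 := by
        intro p hp
        by_contra e
        have := hL _ (lt₁ (f p)) e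
        omega
      simp only
      rw [key p h', key q (h ▸ h')]
  · intro x
    obtain ⟨L, rfl, hv, hL⟩ := hdel _ (lt₁ (f x))
    have hL' : ∀ p : ({x}ᶜ : Set U'), 1 ≤ col L (φ₁ (f p)) ∧ col L (φ₁ (f p)) ≤ 3 :=
      fun p => hL _ (lt₁ _) fun e => p.2 (inj e)
    refine ⟨_, isPackingColoring_of_valid (φ := fun p : ({x}ᶜ : Set U') => φ₁ (f p)) hv
      (inj.comp Subtype.val_injective) (fun p q h => ?_) hL' fun p q h h' => ?_⟩
    · refine cadj_iff.2 ⟨hadj _ _ h, ?_, ?_⟩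
      · have := hL' p
        omega
      · have := hL' q
        omega
    · have := hL' p
      omega

end Criterion

/-! ### Subdivisions and linked graphs -/

section Subdivision

variable {V W : Type*}

theorem subdivisionPath_eq_inl {a b x : V} {k i : ℕ} :
    subdivisionPath a b k i = Sum.inl x ↔ (i = 0 ∧ x = a) ∨ (k < i ∧ x = b) := by
  rcases i with _ | i
  · simp [subdivisionPath, eq_comm]
  · simp only [subdivisionPath]
    split_ifs with h
    · simp; omega
    · simp [eq_comm]; omega

theorem subdivisionPath_eq_inr {a b : V} {k i : ℕ} {j : Fin k} :
    subdivisionPath a b k i = Sum.inr j ↔ i = j + 1 := by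
  rcases i with _ | i
  · simp [subdivisionPath]
  · simp only [subdivisionPath]
    split_ifs with h
    · simp [Fin.ext_iff]
    · simp; omega

theorem subdivide_adj {G : SimpleGraph V} {a b : V} {k : ℕ} {p q : V ⊕ Fin k} :
    (subdivide G a b k).Adj p q ↔
      (∃ x y, G.Adj x y ∧ s(x, y) ≠ s(a, b) ∧ p = Sum.inl x ∧ q = Sum.inl y) ∨
      (∃ i ≤ k, (subdivisionPath a b k i = p ∧ subdivisionPath a b k (i + 1) = q) ∨
        (subdivisionPath a b k i = q ∧ subdivisionPath a b k (i + 1) = p)) ∧ p ≠ q := by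
  simp only [subdivide, sup_adj, map_adj, deleteEdges_adj, fromEdgeSet_adj, Set.mem_ofPred_eq,
    Sym2.eq_iff, Function.Embedding.inl_apply, Set.mem_singleton_iff]
  grind

theorem subdivide_adj_inl_inl {G : SimpleGraph V} {a b : V} (hab : a ≠ b) {k : ℕ} {x y : V} :
    (subdivide G a b k).Adj (Sum.inl x) (Sum.inl y) ↔
      (G.Adj x y ∧ s(x, y) ≠ s(a, b)) ∨ (k = 0 ∧ s(x, y) = s(a, b)) := by
  simp only [subdivide_adj, subdivisionPath_eq_inl, Sum.inl.injEq, ne_eq, Sym2.eq_iff]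
  constructor
  · rintro (⟨_, _, h1, h2, rfl, rfl⟩ | ⟨⟨i, hi, h⟩, hne⟩)
    · exact Or.inl ⟨h1, h2⟩
    · right
      rcases h with ⟨⟨rfl, rfl⟩ | ⟨h1, rfl⟩, ⟨h3, rfl⟩ | ⟨h4, rfl⟩⟩ |
        ⟨⟨rfl, rfl⟩ | ⟨h1, rfl⟩, ⟨h3, rfl⟩ | ⟨h4, rfl⟩⟩ <;> first | omega | skip
      · exact ⟨by omega, by simp⟩
      · exact ⟨by omega, by simp⟩
  · rintro (⟨h1, h2⟩ | ⟨rfl, ⟨rfl, rfl⟩ | ⟨rfl, rfl⟩⟩)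
    · exact Or.inl ⟨_, _, h1, h2, rfl, rfl⟩
    · exact Or.inr ⟨⟨0, le_rfl, by simp⟩, hab⟩
    · exact Or.inr ⟨⟨0, le_rfl, by simp⟩, hab.symm⟩

theorem subdivide_adj_inl_inr {G : SimpleGraph V} {a b : V} {k : ℕ} {x : V} {i : Fin k} :
    (subdivide G a b k).Adj (Sum.inl x) (Sum.inr i) ↔
      (x = a ∧ (i : ℕ) = 0) ∨ (x = b ∧ (i : ℕ) + 1 = k) := by
  have := i.2
  simp only [subdivide_adj, subdivisionPath_eq_inl, subdivisionPath_eq_inr, reduceCtorEq, and_false,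
    exists_false, false_or, ne_eq, not_false_eq_true, and_true]
  constructor
  · rintro ⟨j, hj, ⟨⟨rfl, rfl⟩ | ⟨h1, rfl⟩, h2⟩ | ⟨h2, ⟨h3, rfl⟩ | ⟨h4, rfl⟩⟩⟩
    · exact Or.inl ⟨rfl, by omega⟩
    · omega
    · exact absurd h3 (by simp)
    · exact Or.inr ⟨rfl, by omega⟩
  · rintro (⟨rfl, h⟩ | ⟨rfl, h⟩)
    · exact ⟨0, by omega, by simp [h]⟩
    · exact ⟨k, by omega, by right; exact ⟨h.symm, Or.inr ⟨by omega, rfl⟩⟩⟩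

theorem subdivide_adj_inr_inr {G : SimpleGraph V} {a b : V} {k : ℕ} {i j : Fin k} :
    (subdivide G a b k).Adj (Sum.inr i) (Sum.inr j) ↔
      (i : ℕ) + 1 = j ∨ (j : ℕ) + 1 = i := by
  have := i.2
  have := j.2
  simp only [subdivide_adj, subdivisionPath_eq_inr, reduceCtorEq, and_false,
    exists_false, false_or, ne_eq, Sum.inr.injEq, Fin.ext_iff]
  constructor
  · rintro ⟨⟨n, hn, h | h⟩, -⟩ <;> omega
  · rintro (h | h)
    · exact ⟨⟨i + 1, by omega, by omega⟩, by omega⟩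
    · exact ⟨⟨j + 1, by omega, by omega⟩, by omega⟩

theorem link_adj_left {A : SimpleGraph V} {x : V} {B : SimpleGraph W} {y : W} {l : ℕ} {a a' : V} :
    (link A x B y l).Adj (Sum.inl (Sum.inl a)) (Sum.inl (Sum.inl a')) ↔ A.Adj a a' := by
  simp [link, subdivide_adj_inl_inl, edge_adj]

theorem link_adj_right {A : SimpleGraph V} {x : V} {B : SimpleGraph W} {y : W} {l : ℕ} {b b' : W} :
    (link A x B y l).Adj (Sum.inl (Sum.inr b)) (Sum.inl (Sum.inr b')) ↔ B.Adj b b' := by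
  simp [link, subdivide_adj_inl_inl, edge_adj]

theorem link_adj_left_right {A : SimpleGraph V} {x : V} {B : SimpleGraph W} {y : W} {l : ℕ} {a : V}
    {b : W} : (link A x B y l).Adj (Sum.inl (Sum.inl a)) (Sum.inl (Sum.inr b)) ↔
      l = 0 ∧ a = x ∧ b = y := by
  simp [link, subdivide_adj_inl_inl, edge_adj]

end Subdivision

/-- A numbering `φ` of the vertices of `H` by the indices of two words of equal length, such that
`H` lies between the graphs encoded by the two words. -/
structure Layout {U : Type*} (H : SimpleGraph U) (w₀ w₁ : List Letter) (φ : U → ℕ) : Prop where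
  length_eq : w₀.length = w₁.length
  lt : ∀ v, φ v < w₁.length
  inj : Function.Injective φ
  surj : ∀ i < w₁.length, ∃ v, φ v = i
  lower : ∀ p q, wadj w₀ (φ p) (φ q) → H.Adj p q
  upper : ∀ p q, H.Adj p q → wadj w₁ (φ p) (φ q)

/-- The only edge that leaves the word towards larger indices is the one from its last index to the
next index. -/
def Exits (w : List Letter) : Prop :=
  (w.getD (w.length - 1) (false, false)) = (true, false) ∧
    (w.getD (w.length - 2) (false, false)).2 = false

instance (w : List Letter) : Decidable (Exits w) := inferInstanceAs (Decidable (_ ∧ _))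

/-- A path of `l` vertices, the last of which is adjacent to the vertex that follows. -/
def pathWord (l : ℕ) : List Letter := List.replicate l (true, false)

/-- The part of `wadj` where the second index is larger. -/
def fadj (w : List Letter) (i j : ℕ) : Prop :=
  (j = i + 1 ∧ (w.getD i (false, false)).1 = true) ∨ (j = i + 2 ∧ (w.getD i (false, false)).2 = true)

theorem wadj_iff {w : List Letter} {i j : ℕ} : wadj w i j ↔ fadj w i j ∨ fadj w j i := by
  simp only [wadj, fadj, Bool.or_eq_true, Bool.and_eq_true, beq_iff_eq]
  tauto

theorem fadj_append_left {x y : List Letter} {i j : ℕ} (hi : i < x.length) :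
    fadj (x ++ y) i j ↔ fadj x i j := by
  simp only [fadj, getD_append, hi, if_true]

theorem fadj_append_right {x y : List Letter} {n i j : ℕ} (hx : x.length = n) :
    fadj (x ++ y) (n + i) (n + j) ↔ fadj y i j := by
  subst hx
  simp only [fadj, getD_append, Nat.not_lt.2 (Nat.le_add_right _ _), if_false, Nat.add_sub_cancel_left]
  apply or_congr <;> apply and_congr_left' <;> omega

theorem getD_pathWord {l i : ℕ} (h : i < l) : (pathWord l).getD i (false, false) = (true, false) := by
  simp [pathWord, h]

/-- The numbering of the vertices of `link A x B y l`: first `A`, then the path, then `B`. -/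
def linkIndex {V W : Type*} {l : ℕ} (n : ℕ) (e : V → ℕ) (f : W → ℕ) : (V ⊕ W) ⊕ Fin l → ℕ
  | Sum.inl (Sum.inl a) => e a
  | Sum.inl (Sum.inr b) => n + l + f b
  | Sum.inr i => n + i

theorem Layout.link {V W : Type*} {A : SimpleGraph V} {B : SimpleGraph W} {x : V} {y : W}
    {u₀ u₁ v₀ v₁ : List Letter} {e : V → ℕ} {f : W → ℕ} (hA : Layout A u₀ u₁ e)
    (hB : Layout B v₀ v₁ f) (hx : e x + 1 = u₁.length) (hy : f y = 0) (hu₀ : Exits u₀)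
    (hu₁ : Exits u₁) (l : ℕ) :
    Layout (link A x B y l) (u₀ ++ (pathWord l ++ v₀)) (u₁ ++ (pathWord l ++ v₁))
      (linkIndex u₁.length e f) := by
  have hl : (pathWord l).length = l := by simp [pathWord]
  have hlen := hA.length_eq
  have ex : ∀ a, e a + 1 = u₁.length → a = x := fun a h => hA.inj (by omega)
  have fy : ∀ b, f b = 0 → b = y := fun b h => hB.inj (by omega)
  refine ⟨?_, ?_, ?_, ?_, ?_, ?_⟩
  · simp [hA.length_eq, hB.length_eq]
  · rintro ((a | b) | i)
    · have := hA.lt a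
      simp [linkIndex]; omega
    · have := hB.lt b
      simp [linkIndex, pathWord]; omega
    · simp [linkIndex, pathWord]; omega
  · rintro ((a | b) | i) ((a' | b') | i') h <;> simp only [linkIndex] at h
    · rw [hA.inj h]
    · have := hA.lt a
      omega
    · have := hA.lt a
      omega
    · have := hA.lt a'
      omega
    · rw [hB.inj (by omega : f b = f b')]
    · omega
    · have := hA.lt a'
      omega
    · omega
    · rw [Fin.ext (by omega : (i : ℕ) = i')]
  · intro i hi
    simp only [List.length_append, hl] at hi
    by_cases h1 : i < u₁.length
    · obtain ⟨a, rfl⟩ := hA.surj i h1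
      exact ⟨Sum.inl (Sum.inl a), rfl⟩
    by_cases h2 : i < u₁.length + l
    · exact ⟨Sum.inr ⟨i - u₁.length, by omega⟩, by simp [linkIndex]; omega⟩
    · obtain ⟨b, hb⟩ := hB.surj (i - u₁.length - l) (by omega)
      exact ⟨Sum.inl (Sum.inr b), by simp [linkIndex, hb]; omega⟩
  · suffices H : ∀ p q, fadj (u₀ ++ (pathWord l ++ v₀)) (linkIndex u₁.length e f p)
        (linkIndex u₁.length e f q) → (PackingColoring.link A x B y l).Adj p q by
      intro p q h
      rcases wadj_iff.1 h with h | h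
      · exact H p q h
      · exact (H q p h).symm
    have hexit : ∀ a j, u₀.length ≤ j → fadj (u₀ ++ (pathWord l ++ v₀)) (e a) j →
        j = u₀.length ∧ a = x := by
      intro a j hj h
      have ha := hA.lt a
      rw [fadj_append_left (by omega)] at h
      rcases h with ⟨rfl, h⟩ | ⟨rfl, h⟩
      · exact ⟨by omega, ex a (by omega)⟩
      · have : e a = u₀.length - 1 ∨ e a = u₀.length - 2 := by omega
        rcases this with e | e
        · rw [e, hu₀.1] at h
          simp at h
        · rw [e, hu₀.2] at h
          simp at h
    have hB0 : ∀ b j, fadj (u₀ ++ (pathWord l ++ v₀)) (u₁.length + l + f b) j →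
        ∃ j', j = u₁.length + l + j' ∧ fadj v₀ (f b) j' := by
      intro b j h
      have : u₁.length + l + f b ≤ j := by
        rcases h with h | h <;> omega
      obtain ⟨j', rfl⟩ := Nat.exists_eq_add_of_le (le_trans (Nat.le_add_right _ _) this)
      refine ⟨j', rfl, ?_⟩
      rw [add_assoc, add_assoc, fadj_append_right hlen] at h
      rwa [fadj_append_right hl] at h
    have hP0 : ∀ (i : Fin l) j, fadj (u₀ ++ (pathWord l ++ v₀)) (u₁.length + i) j →
        j = u₁.length + i + 1 := by
      intro i j h
      have : u₁.length + i ≤ j := by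
        rcases h with h | h <;> omega
      obtain ⟨j', rfl⟩ := Nat.exists_eq_add_of_le (le_trans (Nat.le_add_right _ _) this)
      rw [fadj_append_right hlen, fadj_append_left (by rw [hl]; exact i.2)] at h
      simp only [fadj, getD_pathWord i.2] at h
      simp at h
      omega
    rintro ((a | b) | i) ((a' | b') | i') h <;> simp only [linkIndex] at h
    · rw [link_adj_left]
      apply hA.lower
      have := hA.lt a
      rw [fadj_append_left (by omega)] at h
      exact wadj_iff.2 (Or.inl h)
    · obtain ⟨h1, rfl⟩ := hexit a _ (by omega) h
      exact link_adj_left_right.2 ⟨by omega, rfl, fy _ (by omega)⟩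
    · obtain ⟨h1, rfl⟩ := hexit a _ (by omega) h
      exact subdivide_adj_inl_inr.2 (Or.inl ⟨rfl, by omega⟩)
    · obtain ⟨j, h1, -⟩ := hB0 _ _ h
      have := hA.lt a'
      omega
    · obtain ⟨j, h1, h2⟩ := hB0 _ _ h
      rw [link_adj_right]
      apply hB.lower
      rw [show f b' = j by omega]
      exact wadj_iff.2 (Or.inl h2)
    · obtain ⟨j, h1, -⟩ := hB0 _ _ h
      omega
    · have := hP0 _ _ h
      have := hA.lt a'
      omega
    · have := hP0 _ _ h
      exact (subdivide_adj_inl_inr.2 (Or.inr ⟨by rw [fy b' (by omega)], by omega⟩)).symm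
    · have := hP0 _ _ h
      exact subdivide_adj_inr_inr.2 (Or.inl (by omega))
  · have hP : ∀ i, i < l → fadj (u₁ ++ (pathWord l ++ v₁)) (u₁.length + i) (u₁.length + i + 1) := by
      intro i hi
      rw [add_assoc, fadj_append_right rfl, fadj_append_left (by rwa [hl])]
      exact Or.inl ⟨rfl, by rw [getD_pathWord hi]⟩
    have hX : fadj (u₁ ++ (pathWord l ++ v₁)) (e x) u₁.length := by
      rw [fadj_append_left (by omega)]
      exact Or.inl ⟨hx.symm, by rw [show e x = u₁.length - 1 by omega, hu₁.1]⟩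
    have hLR : ∀ a b, (PackingColoring.link A x B y l).Adj (Sum.inl (Sum.inl a))
        (Sum.inl (Sum.inr b)) →
        fadj (u₁ ++ (pathWord l ++ v₁)) (e a) (u₁.length + l + f b) := by
      intro a b h
      obtain ⟨rfl, rfl, rfl⟩ := link_adj_left_right.1 h
      simpa [hy] using hX
    have hLP : ∀ a (i : Fin l), (PackingColoring.link A x B y l).Adj (Sum.inl (Sum.inl a))
        (Sum.inr i) → fadj (u₁ ++ (pathWord l ++ v₁)) (e a) (u₁.length + i) := by
      intro a i h
      rcases subdivide_adj_inl_inr.1 h with ⟨h, hi⟩ | ⟨h, hi⟩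
      · rw [Sum.inl.inj h, hi]
        exact hX
      · simp at h
    have hPR : ∀ b (i : Fin l), (PackingColoring.link A x B y l).Adj (Sum.inl (Sum.inr b))
        (Sum.inr i) → fadj (u₁ ++ (pathWord l ++ v₁)) (u₁.length + i) (u₁.length + l + f b) := by
      intro b i h
      rcases subdivide_adj_inl_inr.1 h with ⟨h, hi⟩ | ⟨h, hi⟩
      · simp at h
      · have := hP i i.2
        rwa [show u₁.length + (i : ℕ) + 1 = u₁.length + l + f b by
          rw [Sum.inr.inj h, hy]; omega] at this
    rintro ((a | b) | i) ((a' | b') | i') h <;> rw [wadj_iff] <;> simp only [linkIndex]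
    · have := wadj_iff.1 (hA.upper _ _ (link_adj_left.1 h))
      rwa [fadj_append_left (hA.lt a), fadj_append_left (hA.lt a')]
    · exact Or.inl (hLR _ _ h)
    · exact Or.inl (hLP _ _ h)
    · exact Or.inr (hLR _ _ h.symm)
    · have := wadj_iff.1 (hB.upper _ _ (link_adj_right.1 h))
      rwa [add_assoc, add_assoc, fadj_append_right rfl, fadj_append_right rfl, fadj_append_right hl,
        fadj_append_right hl]
    · exact Or.inr (hPR _ _ h)
    · exact Or.inr (hLP _ _ h.symm)
    · exact Or.inl (hPR _ _ h.symm)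
    · rcases subdivide_adj_inr_inr.1 h with h | h
      · rw [← h]
        exact Or.inl (hP i i.2)
      · rw [← h]
        exact Or.inr (hP i' i'.2)

/-! ### Words without a coloring -/

/-- The first six cells of a valid colored word with the letters `w` and colors in `{1, 2, 3}`
belong to `T`. -/
def Reaches (w : List Letter) (T : List (List Cell)) : Prop :=
  ∀ L : List Cell, L.map Prod.fst = w → (∀ c ∈ L, Proper c) → valid L → L.take 6 ∈ T

theorem Reaches.append {w : List Letter} {T : List (List Cell)} (h : Reaches w T)
    (x : List Letter) : Reaches (x ++ w) (run x T) := by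
  intro L hL hp hv
  rw [List.map_eq_append_iff] at hL
  obtain ⟨y, t, rfl, rfl, ht⟩ := hL
  exact take_mem_run (fun c hc => hp c (by simp [hc])) hv
    (h t ht (fun c hc => hp c (by simp [hc])) (valid_of_append hv))

theorem reaches_run (w : List Letter) : Reaches w (run w [[]]) := by
  have h : Reaches [] [[]] := by
    intro L hL _ _
    simp [List.map_eq_nil_iff.1 hL]
  simpa using h.append w

theorem Reaches.pump {w m : List Letter} {S : List (List Cell)} (h : Reaches w S) (n : ℕ)
    (hT : ∀ s ∈ run m (orbit m S n), s ∈ orbit m S n) (k : ℕ) :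
    Reaches (rep k m ++ w) (orbit m S n) := by
  intro L hL hp hv
  rw [List.map_eq_append_iff] at hL
  obtain ⟨y, t, rfl, hy, ht⟩ := hL
  exact take_mem_run_rep hT k (fun c hc => hp c (by simp [hc])) hy hv
    (mem_orbit (h t ht (fun c hc => hp c (by simp [hc])) (valid_of_append hv)) n)

theorem Reaches.notColorable {w : List Letter} {T : List (List Cell)} (h : Reaches w T)
    (hT : T = []) : NotColorable w := by
  intro L hL hp hv
  simpa [hT] using h L hL hp hv

/-- The windows reached from the end `z` by at most `n` blocks of the path are closed under a
further block, and none of them extends to the end `u`. -/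
theorem notColorable_pump {u z : List Letter} (n : ℕ)
    (h : (∀ s ∈ run (pathWord 4) (orbit (pathWord 4) (run z [[]]) n),
      s ∈ orbit (pathWord 4) (run z [[]]) n) ∧ run u (orbit (pathWord 4) (run z [[]]) n) = [])
    (k : ℕ) : NotColorable (u ++ (rep k (pathWord 4) ++ z)) :=
  (((reaches_run z).pump n h.1 k).append u).notColorable h.2

/-! ### Explicit colorings -/

theorem pathWord_add (a b : ℕ) : pathWord (a + b) = pathWord a ++ pathWord b := by
  simp [pathWord]

theorem pathWord_mul_add (k r : ℕ) : pathWord (4 * k + r) = rep k (pathWord 4) ++ pathWord r :=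
  replicate_mul_add k r _

theorem pathWord_add_mul (k r : ℕ) : pathWord (4 * k + r) = pathWord r ++ rep k (pathWord 4) := by
  rw [add_comm, pathWord_add, show 4 * k = 4 * k + 0 from rfl, pathWord_mul_add]
  simp [pathWord]

/-- The word `w` with the colors in the list `c`. -/
abbrev paint (w : List Letter) (c : List ℕ) : List Cell := w.zip c

theorem map_fst_paint {w : List Letter} {c : List ℕ} (h : w.length = c.length) :
    (paint w c).map Prod.fst = w := List.map_fst_zip h.le

/-- All cells have a color in `{1, 2, 3}`, except possibly the one at the index `i`. -/
def ProperOff (L : List Cell) (i : ℕ) : Prop :=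
  ∀ j < L.length, j ≠ i → 1 ≤ col L j ∧ col L j ≤ 3

instance (L : List Cell) (i : ℕ) : Decidable (ProperOff L i) := Nat.decidableBallLT _ _

/-- All cells have a color in `{1, 2, 3}`. -/
def AllProper (L : List Cell) : Prop := ∀ c ∈ L, Proper c

instance (L : List Cell) : Decidable (AllProper L) := List.decidableBAll _ _

theorem AllProper.col {L : List Cell} (h : AllProper L) {j : ℕ} (hj : j < L.length) :
    1 ≤ col L j ∧ col L j ≤ 3 := by
  have := h L[j] (List.getElem_mem hj)
  simpa [PackingColoring.col, hj, Proper] using this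

theorem AllProper.append {x y : List Cell} (hx : AllProper x) (hy : AllProper y) :
    AllProper (x ++ y) := by
  intro c hc
  rcases List.mem_append.1 hc with h | h
  · exact hx c h
  · exact hy c h

theorem AllProper.rep {m : List Cell} (hm : AllProper m) (k : ℕ) : AllProper (rep k m) :=
  fun c hc => hm c (mem_of_mem_rep hc)

theorem ProperOff.append_left {x y : List Cell} {i : ℕ} (hx : ProperOff x i) (hy : AllProper y) :
    ProperOff (x ++ y) i := by
  intro j hj hji
  rw [col_append]
  rw [List.length_append] at hj
  split_ifs with h
  · exact hx j h hji
  · exact hy.col (by omega)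

theorem ProperOff.append_right {x y : List Cell} {n i : ℕ} (hn : x.length = n) (hx : AllProper x)
    (hy : ProperOff y i) : ProperOff (x ++ y) (n + i) := by
  intro j hj hji
  rw [col_append]
  rw [List.length_append] at hj
  split_ifs with h
  · exact hx.col h
  · exact hy _ (by omega) (by omega)

/-- The encoded graph has a packing coloring with the colors `1`, `2`, `3`. -/
def Colorable (w : List Letter) : Prop :=
  ∃ L : List Cell, L.map Prod.fst = w ∧ valid L ∧ AllProper L

theorem colorableOff_of_properOff {w : List Letter} {i : ℕ} {L : List Cell} (h : L.map Prod.fst = w)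
    (hv : valid L) (hL : ProperOff L i) : ColorableOff w i :=
  ⟨L, h, hv, by rw [← h, List.length_map]; exact hL⟩

theorem colorableOff_cut {w₁ w₂ : List Letter} (e : Letter) (h₁ : Colorable w₁)
    (h₂ : Colorable w₂) (h : (w₁.getD (w₁.length - 1) (false, false)).2 = false) :
    ColorableOff (w₁ ++ (e :: w₂)) w₁.length := by
  obtain ⟨L₁, rfl, hv₁, hp₁⟩ := h₁
  obtain ⟨L₂, rfl, hv₂, hp₂⟩ := h₂
  refine colorableOff_of_properOff (L := L₁ ++ ((e, 0) :: L₂)) (by simp) (valid_cut hv₁ hv₂ ?_) ?_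
  · rw [show ((false, false) : Letter) = Prod.fst (((false, false), 0) : Cell) from rfl,
      List.getD_map, List.length_map] at h
    exact h
  · refine ProperOff.append_right (i := 0) (by simp) hp₁ ?_
    intro j hj hj0
    obtain ⟨j, rfl⟩ := Nat.exists_eq_succ_of_ne_zero hj0
    exact hp₂.col (by simpa using hj)

/-- The colors `x` of `u`, `m` of the blocks of four path vertices and `y` of `z` give valid colored
words for any number of blocks. -/
def PumpRow (u z : List Letter) (x m y : List ℕ) : Prop :=
  (u.length = x.length ∧ m.length = 4 ∧ z.length = y.length ∧ AllProper (paint (pathWord 4) m)) ∧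
    valid (rep 3 (paint (pathWord 4) m)) ∧
    ∀ k < 3, valid (paint u x ++ (rep k (paint (pathWord 4) m) ++ paint z y))

instance (u z : List Letter) (x m y : List ℕ) : Decidable (PumpRow u z x m y) :=
  inferInstanceAs (Decidable (_ ∧ _))

section PumpRow

variable {u z : List Letter} {x m y : List ℕ}

theorem PumpRow.map_fst (h : PumpRow u z x m y) (k : ℕ) :
    (paint u x ++ (rep k (paint (pathWord 4) m) ++ paint z y)).map Prod.fst =
      u ++ (rep k (pathWord 4) ++ z) := by
  obtain ⟨⟨h1, h2, h3, -⟩, -⟩ := h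
  rw [List.map_append, List.map_append, map_rep, map_fst_paint h1, map_fst_paint h3,
    map_fst_paint (by simp [pathWord, h2])]

theorem PumpRow.valid (h : PumpRow u z x m y) (k : ℕ) :
    PackingColoring.valid (paint u x ++ (rep k (paint (pathWord 4) m) ++ paint z y)) :=
  valid_pump (by simp [pathWord, h.1.2.1]) h.2.1 h.2.2 k

theorem PumpRow.colorable (h : PumpRow u z x m y) (hu : AllProper (paint u x))
    (hz : AllProper (paint z y)) (k : ℕ) : Colorable (u ++ (rep k (pathWord 4) ++ z)) :=
  ⟨_, h.map_fst k, h.valid k, hu.append ((h.1.2.2.2.rep k).append hz)⟩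

theorem PumpRow.colorableOff_left {i : ℕ}
    (h : PumpRow u z x m y ∧ ProperOff (paint u x) i ∧ AllProper (paint z y)) (k : ℕ) :
    ColorableOff (u ++ (rep k (pathWord 4) ++ z)) i :=
  colorableOff_of_properOff (h.1.map_fst k) (h.1.valid k)
    (h.2.1.append_left ((h.1.1.2.2.2.rep k).append h.2.2))

theorem PumpRow.colorableOff_right {i : ℕ}
    (h : PumpRow u z x m y ∧ AllProper (paint u x) ∧ ProperOff (paint z y) i) (k : ℕ) :
    ColorableOff (u ++ (rep k (pathWord 4) ++ z)) (u.length + (4 * k + i)) := by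
  obtain ⟨⟨h1, h2, h3, h4⟩, -⟩ := h.1
  refine colorableOff_of_properOff (h.1.map_fst k) (h.1.valid k)
    (ProperOff.append_right (by simp [h1]) h.2.1
      (ProperOff.append_right ?_ (h4.rep k) h.2.2))
  simp [length_rep, pathWord, h2, mul_comm]

theorem PumpRow.colorableFour
    (h : PumpRow u z x m y ∧ ProperOff (paint u x) 0 ∧ AllProper (paint z y) ∧
      0 < (paint u x).length ∧ col (paint u x) 0 = 4) (k : ℕ) :
    ColorableFour (u ++ (rep k (pathWord 4) ++ z)) := by
  refine ⟨_, h.1.map_fst k, h.1.valid k, ?_, ?_⟩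
  · rw [col_append, if_pos h.2.2.2.1, h.2.2.2.2]
  · rw [← h.1.map_fst k, List.length_map]
    exact h.2.1.append_left ((h.1.1.2.2.2.rep k).append h.2.2.1)

end PumpRow

/-- A word followed by a path of any length is colorable, if a periodic coloring of the path can be
attached to a coloring of the word. -/
theorem colorable_append_pathWord {u : List Letter} {x m : List ℕ}
    (h : AllProper (paint u x) ∧ ∀ r < 4, PumpRow u (pathWord r) x m (m.take r) ∧
      AllProper (paint (pathWord r) (m.take r))) (j : ℕ) :
    Colorable (u ++ pathWord j) := by
  obtain ⟨h1, h2⟩ := h.2 (j % 4) (Nat.mod_lt _ (by norm_num))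
  rw [← Nat.div_add_mod j 4, pathWord_mul_add]
  exact h1.colorable h.1 h2 _

/-- The mirror image of `colorable_append_pathWord`. -/
theorem colorable_pathWord_append {z : List Letter} {m y : List ℕ}
    (h : AllProper (paint z y) ∧ ∀ r < 4, PumpRow (pathWord r) z (m.drop (4 - r)) m y ∧
      AllProper (paint (pathWord r) (m.drop (4 - r)))) (j : ℕ) :
    Colorable (pathWord j ++ z) := by
  obtain ⟨h1, h2⟩ := h.2 (j % 4) (Nat.mod_lt _ (by norm_num))
  rw [← Nat.div_add_mod j 4, pathWord_add_mul, List.append_assoc]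
  exact h1.colorable h2 h.1 _

/-! ### Criticality of the graphs `link` -/

/-- `A` with root `x` lies between the graphs of two words that end with the root. -/
def LeftEnd {V : Type*} (A : SimpleGraph V) (x : V) (u₀ u₁ : List Letter) : Prop :=
  ∃ e, Layout A u₀ u₁ e ∧ e x + 1 = u₁.length

/-- `B` with root `y` lies between the graphs of two words that start with the root. -/
def RightEnd {V : Type*} (B : SimpleGraph V) (y : V) (v₀ v₁ : List Letter) : Prop :=
  ∃ f, Layout B v₀ v₁ f ∧ f y = 0

theorem getD_append_pathWord {u : List Letter} (hu : Exits u) (j : ℕ) :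
    ((u ++ pathWord j).getD ((u ++ pathWord j).length - 1) (false, false)).2 = false := by
  rcases j with _ | j
  · simp only [pathWord, List.replicate_zero, List.append_nil]
    rw [hu.1]
  · simp [pathWord, ← add_assoc]

/-- The deletion of a vertex of the path leaves the two ends, each with a part of the path attached,
which are colorable by `tL` and `tR`. -/
theorem link_critical {U V W : Type*} {G : SimpleGraph U} {A : SimpleGraph V} {B : SimpleGraph W}
    {x : V} {y : W} {u₀ u₁ v₀ v₁ : List Letter} {l : ℕ} (f : G ≃g link A x B y l)
    (hA : LeftEnd A x u₀ u₁) (hB : RightEnd B y v₀ v₁) (hu₀ : Exits u₀) (hu₁ : Exits u₁)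
    (hno : NotColorable (u₀ ++ (pathWord l ++ v₀)))
    (h4 : ColorableFour (u₁ ++ (pathWord l ++ v₁)))
    (hL : ∀ i < u₁.length, ColorableOff (u₁ ++ (pathWord l ++ v₁)) i)
    (hR : ∀ i < v₁.length, ColorableOff (u₁ ++ (pathWord l ++ v₁)) (u₁.length + (l + i)))
    (tL : ∀ j, Colorable (u₁ ++ pathWord j)) (tR : ∀ j, Colorable (pathWord j ++ v₁)) :
    IsKPackingVertexCritical 4 G := by
  obtain ⟨e, hA, hx⟩ := hA
  obtain ⟨g, hB, hy⟩ := hB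
  have H := hA.link hB hx hy hu₀ hu₁ l
  refine critical_of_words f (by rw [H.length_eq]; exact H.surj) H.lower hno H.inj H.lt H.upper
    (fun i hi => ?_) h4
  have hl : ∀ l, (pathWord l).length = l := by simp [pathWord]
  simp only [List.length_append, hl] at hi
  by_cases h1 : i < u₁.length
  · exact hL i h1
  obtain ⟨i, rfl⟩ := Nat.exists_eq_add_of_le (not_lt.1 h1)
  by_cases h2 : i < l
  · obtain ⟨j, rfl⟩ : ∃ j, l = i + (1 + j) := ⟨l - i - 1, by omega⟩
    have := colorableOff_cut (true, false) (tL i) (tR j) (getD_append_pathWord hu₁ i)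
    rw [pathWord_add, pathWord_add]
    simpa [hl, pathWord] using this
  · obtain ⟨i, rfl⟩ := Nat.exists_eq_add_of_le (not_lt.1 h2)
    exact hR i (by omega)

/-! ### The end graphs -/

theorem Layout.of_fin {n : ℕ} {H : SimpleGraph (Fin n)} {w₀ w₁ : List Letter} (σ : Fin n → Fin n)
    (h₀ : w₀.length = n) (h₁ : w₁.length = n)
    (h : (∀ a b, σ a = σ b → a = b) ∧ (∀ a b, wadj w₀ (σ a) (σ b) → H.Adj a b) ∧
      ∀ a b, H.Adj a b → wadj w₁ (σ a) (σ b)) :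
    Layout H w₀ w₁ fun a => σ a where
  length_eq := h₀.trans h₁.symm
  lt v := h₁ ▸ (σ v).2
  inj a b hab := h.1 a b (Fin.ext hab)
  surj i hi := by
    have hσ : Function.Injective σ := fun a b => h.1 a b
    obtain ⟨v, hv⟩ := Finite.surjective_of_injective hσ ⟨i, h₁ ▸ hi⟩
    exact ⟨v, by rw [hv]⟩
  lower := h.2.1
  upper := h.2.2

/-- A triangle, ending with its root. -/
def triangleL : List Letter := [(true, true), (true, false), (true, false)]

/-- A triangle, starting with its root. -/
def triangleR : List Letter := [(true, true), (true, false), (false, false)]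

/-- A path on three vertices, ending with its middle vertex. -/
def cherryL : List Letter := [(false, true), (true, false), (true, false)]

/-- A path on three vertices, starting with its middle vertex. -/
def cherryR : List Letter := [(true, true), (false, false), (false, false)]

/-- A path on four vertices, or a cycle if `c` holds, ending with a non-pendant vertex. -/
def squareL (c : Bool) : List Letter := [(true, c), (false, true), (true, false), (true, false)]

/-- A path on four vertices, or a cycle if `c` holds, starting with a non-pendant vertex. -/
def squareR (c : Bool) : List Letter := [(true, true), (false, c), (true, false), (false, false)]

theorem leftEnd_triangle (x : Fin 3) : LeftEnd K3 x triangleL triangleL := by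
  refine ⟨_, Layout.of_fin (Equiv.swap x 2) rfl rfl ?_, by simp [triangleL]⟩
  revert x
  decide

theorem rightEnd_triangle (x : Fin 3) : RightEnd K3 x triangleR triangleR := by
  refine ⟨_, Layout.of_fin (Equiv.swap x 0) rfl rfl ?_, by simp⟩
  revert x
  decide

theorem eq_one_of_isNonPendant {x : Fin 3} (h : IsNonPendant (pathGraph 3) x) : x = 1 := by
  by_contra hx
  have hs : (pathGraph 3).neighborSet x ⊆ {1} := by
    intro y hy
    rw [mem_neighborSet, pathGraph_adj] at hy
    rw [Set.mem_singleton_iff]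
    omega
  exact absurd (h.trans_le ((Set.encard_le_encard hs).trans_eq (Set.encard_singleton _)))
    (lt_irrefl _)

theorem rightEnd_cherry {x : Fin 3} (h : IsNonPendant (pathGraph 3) x) :
    RightEnd (pathGraph 3) x cherryR cherryR := by
  rw [eq_one_of_isNonPendant h]
  refine ⟨_, Layout.of_fin ![1, 0, 2] rfl rfl ?_, rfl⟩
  simp only [pathGraph_adj]
  decide

theorem eq_one_or_two_of_isNonPendant {x : Fin 4} (h : IsNonPendant (pathGraph 4) x) :
    x = 1 ∨ x = 2 := by
  by_contra hx
  have hs : (pathGraph 4).neighborSet x ⊆ {if x = 0 then 1 else 2} := by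
    intro y hy
    rw [mem_neighborSet, pathGraph_adj] at hy
    rw [Set.mem_singleton_iff]
    split_ifs <;> omega
  exact absurd (h.trans_le ((Set.encard_le_encard hs).trans_eq (Set.encard_singleton _)))
    (lt_irrefl _)

/-- Both for `P₄` and for `C₄`, a numbering that starts with the vertex opposite to the root and
ends with the root. -/
theorem exists_square_numbering {A : SimpleGraph (Fin 4)} (hA : A = pathGraph 4 ∨ A = cycleGraph 4)
    {x : Fin 4} (hx : IsNonPendant A x) : ∃ σ : Fin 4 → Fin 4, σ x = 3 ∧
      (∀ a b, σ a = σ b → a = b) ∧ (∀ a b, wadj (squareL false) (σ a) (σ b) → A.Adj a b) ∧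
      ∀ a b, A.Adj a b → wadj (squareL true) (σ a) (σ b) := by
  rcases hA with rfl | rfl
  · simp only [pathGraph_adj]
    rcases eq_one_or_two_of_isNonPendant hx with rfl | rfl
    · exact ⟨![2, 3, 1, 0], by decide⟩
    · exact ⟨![0, 1, 3, 2], by decide⟩
  · refine ⟨fun a => ![3, 1, 0, 2] (a - x), ?_⟩
    clear hx
    revert x
    decide

theorem leftEnd_square {A : SimpleGraph (Fin 4)} (hA : A = pathGraph 4 ∨ A = cycleGraph 4)
    {x : Fin 4} (hx : IsNonPendant A x) : LeftEnd A x (squareL false) (squareL true) := by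
  obtain ⟨σ, h1, h2⟩ := exists_square_numbering hA hx
  exact ⟨_, Layout.of_fin σ rfl rfl h2, by rw [h1]; rfl⟩

theorem rightEnd_square {A : SimpleGraph (Fin 4)} (hA : A = pathGraph 4 ∨ A = cycleGraph 4)
    {x : Fin 4} (hx : IsNonPendant A x) : RightEnd A x (squareR false) (squareR true) := by
  obtain ⟨σ, h1, h2, h3, h4⟩ := exists_square_numbering hA hx
  have e : ∀ c, ∀ a b : Fin 4, wadj (squareR c) (Fin.rev a) (Fin.rev b) = wadj (squareL c) a b := by
    decide
  refine ⟨_, Layout.of_fin (fun a => Fin.rev (σ a)) rfl rfl ⟨?_, ?_, ?_⟩, by rw [h1]; rfl⟩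
  · intro a b h
    exact h2 a b (Fin.rev_injective h)
  · simpa only [e] using h3
  · simpa only [e] using h4

/-! ### Colorings of the end graphs with a path attached -/

theorem colorable_triangleL (j : ℕ) : Colorable (triangleL ++ pathWord j) :=
  colorable_append_pathWord (x := [1, 2, 3]) (m := [1, 2, 1, 3]) (by decide +kernel) j

theorem colorable_triangleR (j : ℕ) : Colorable (pathWord j ++ triangleR) :=
  colorable_pathWord_append (m := [3, 1, 2, 1]) (y := [3, 1, 2]) (by decide +kernel) j

theorem colorable_cherryL (j : ℕ) : Colorable (cherryL ++ pathWord j) :=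
  colorable_append_pathWord (x := [1, 1, 3]) (m := [1, 2, 1, 3]) (by decide +kernel) j

theorem colorable_cherryR (j : ℕ) : Colorable (pathWord j ++ cherryR) :=
  colorable_pathWord_append (m := [3, 1, 2, 1]) (y := [3, 1, 1]) (by decide +kernel) j

theorem colorable_squareL (j : ℕ) : Colorable (squareL true ++ pathWord j) :=
  colorable_append_pathWord (x := [2, 1, 1, 3]) (m := [1, 2, 1, 3]) (by decide +kernel) j

theorem colorable_squareR (j : ℕ) : Colorable (pathWord j ++ squareR true) :=
  colorable_pathWord_append (m := [3, 1, 2, 1]) (y := [3, 1, 1, 2]) (by decide +kernel) j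

/-! ### The families with two ends -/

/-- Colorings of the two ends `u` and `v` of a graph, which are joined by a path of `4 * k + r`
vertices; each consists of the colors of `u`, of the repeated block, and of the rest. In `c`, the
vertex `0` has the color `4`. The lists `cL` and `cR` have a coloring for the deletion of each
vertex of `u` and of `v`. -/
def PumpTable (u v : List Letter) (r : ℕ) (c : List ℕ × List ℕ × List ℕ)
    (cL cR : List (List ℕ × List ℕ × List ℕ)) : Prop :=
  (PumpRow u (pathWord r ++ v) c.1 c.2.1 c.2.2 ∧ ProperOff (paint u c.1) 0 ∧
    AllProper (paint (pathWord r ++ v) c.2.2) ∧ 0 < (paint u c.1).length ∧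
    col (paint u c.1) 0 = 4) ∧
  (∀ i < u.length, PumpRow u (pathWord r ++ v) (cL.getD i c).1 (cL.getD i c).2.1 (cL.getD i c).2.2 ∧
    ProperOff (paint u (cL.getD i c).1) i ∧ AllProper (paint (pathWord r ++ v) (cL.getD i c).2.2)) ∧
  ∀ i < v.length, PumpRow u (pathWord r ++ v) (cR.getD i c).1 (cR.getD i c).2.1 (cR.getD i c).2.2 ∧
    AllProper (paint u (cR.getD i c).1) ∧
    ProperOff (paint (pathWord r ++ v) (cR.getD i c).2.2) (r + i)

instance (u v : List Letter) (r : ℕ) (c : List ℕ × List ℕ × List ℕ)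
    (cL cR : List (List ℕ × List ℕ × List ℕ)) : Decidable (PumpTable u v r c cL cR) :=
  inferInstanceAs (Decidable (_ ∧ _))

theorem PumpTable.critical {U V W : Type*} {G : SimpleGraph U} {A : SimpleGraph V}
    {B : SimpleGraph W} {x : V} {y : W} {u₀ u₁ v₀ v₁ : List Letter} {k r : ℕ}
    {c : List ℕ × List ℕ × List ℕ} {cL cR : List (List ℕ × List ℕ × List ℕ)}
    (h : PumpTable u₁ v₁ r c cL cR) (f : G ≃g link A x B y (4 * k + r))
    (hA : LeftEnd A x u₀ u₁) (hB : RightEnd B y v₀ v₁) (hu : Exits u₀ ∧ Exits u₁)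
    (hno : NotColorable (u₀ ++ (rep k (pathWord 4) ++ (pathWord r ++ v₀))))
    (tL : ∀ j, Colorable (u₁ ++ pathWord j)) (tR : ∀ j, Colorable (pathWord j ++ v₁)) :
    IsKPackingVertexCritical 4 G := by
  have e : ∀ v, pathWord (4 * k + r) ++ v = rep k (pathWord 4) ++ (pathWord r ++ v) := by
    intro v
    rw [pathWord_mul_add, List.append_assoc]
  refine link_critical f hA hB hu.1 hu.2 ?_ ?_ ?_ ?_ tL tR
  · rwa [e]
  · rw [e]
    exact PumpRow.colorableFour h.1 k
  · intro i hi
    rw [e]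
    exact PumpRow.colorableOff_left (h.2.1 i hi) k
  · intro i hi
    rw [e, add_assoc]
    exact PumpRow.colorableOff_right (h.2.2 i hi) k

theorem pumpTable_triangle_triangle_zero : PumpTable triangleL triangleR 0
    ([4, 2, 1], [3, 1, 2, 1], [3, 1, 2])
    [([0, 2, 1], [3, 1, 2, 1], [3, 1, 2]),
     ([2, 0, 1], [3, 1, 2, 1], [3, 1, 2]),
     ([1, 2, 0], [3, 1, 2, 1], [3, 1, 2])]
    [([1, 2, 3], [1, 2, 1, 3], [0, 1, 2]),
     ([1, 2, 3], [1, 2, 1, 3], [1, 0, 2]),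
     ([1, 2, 3], [1, 2, 1, 3], [1, 2, 0])] := by
  decide +kernel

theorem pumpTable_triangle_triangle_one : PumpTable triangleL triangleR 1
    ([4, 1, 2], [1, 3, 1, 2], [1, 3, 1, 2])
    [([0, 1, 2], [1, 3, 1, 2], [1, 3, 1, 2]),
     ([1, 0, 2], [1, 3, 1, 2], [1, 3, 1, 2]),
     ([1, 2, 0], [1, 3, 1, 2], [1, 3, 1, 2])]
    [([1, 2, 3], [1, 2, 1, 3], [1, 0, 1, 2]),
     ([1, 2, 3], [1, 2, 1, 3], [1, 2, 0, 1]),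
     ([1, 2, 3], [1, 2, 1, 3], [1, 2, 1, 0])] := by
  decide +kernel

theorem pumpTable_triangle_triangle_two : PumpTable triangleL triangleR 2
    ([4, 3, 1], [2, 1, 3, 1], [2, 1, 3, 1, 2])
    [([0, 3, 1], [2, 1, 3, 1], [2, 1, 3, 1, 2]),
     ([3, 0, 1], [2, 1, 3, 1], [2, 1, 3, 1, 2]),
     ([1, 2, 0], [2, 1, 3, 1], [2, 1, 3, 1, 2])]
    [([1, 2, 3], [1, 2, 1, 3], [1, 2, 0, 1, 2]),
     ([1, 2, 3], [1, 2, 1, 3], [1, 2, 1, 0, 3]),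
     ([1, 2, 3], [1, 2, 1, 3], [1, 2, 1, 3, 0])] := by
  decide +kernel

theorem pumpTable_triangle_cherry_zero : PumpTable triangleL cherryR 0
    ([4, 1, 3], [1, 2, 1, 3], [2, 1, 1])
    [([0, 1, 3], [1, 2, 1, 3], [2, 1, 1]),
     ([1, 0, 3], [1, 2, 1, 3], [2, 1, 1]),
     ([1, 2, 0], [1, 2, 1, 3], [2, 1, 1])]
    [([1, 2, 3], [1, 2, 1, 3], [0, 1, 1]),
     ([1, 2, 3], [1, 2, 1, 3], [1, 0, 2]),
     ([1, 2, 3], [1, 2, 1, 3], [1, 2, 0])] := by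
  decide +kernel

theorem pumpTable_triangle_cherry_two : PumpTable triangleL cherryR 2
    ([4, 3, 1], [2, 1, 3, 1], [2, 1, 3, 1, 1])
    [([0, 3, 1], [2, 1, 3, 1], [2, 1, 3, 1, 1]),
     ([3, 0, 1], [2, 1, 3, 1], [2, 1, 3, 1, 1]),
     ([1, 2, 0], [2, 1, 3, 1], [2, 1, 3, 1, 1])]
    [([1, 2, 3], [1, 2, 1, 3], [1, 2, 0, 1, 1]),
     ([1, 2, 3], [1, 2, 1, 3], [1, 2, 1, 0, 3]),
     ([1, 2, 3], [1, 2, 1, 3], [1, 2, 1, 3, 0])] := by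
  decide +kernel

theorem pumpTable_square_triangle_four : PumpTable (squareL true) triangleR 4
    ([4, 1, 1, 2], [3, 1, 2, 1], [3, 1, 2, 1, 3, 1, 2])
    [([0, 1, 1, 2], [3, 1, 2, 1], [3, 1, 2, 1, 3, 1, 2]),
     ([1, 0, 2, 1], [3, 1, 2, 1], [3, 1, 2, 1, 3, 1, 2]),
     ([1, 2, 0, 1], [3, 1, 2, 1], [3, 1, 2, 1, 3, 1, 2]),
     ([1, 2, 3, 0], [3, 1, 2, 1], [3, 1, 2, 1, 3, 1, 2])]
    [([2, 1, 1, 3], [1, 2, 1, 3], [1, 2, 1, 3, 0, 1, 2]),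
     ([2, 1, 1, 3], [1, 2, 1, 3], [1, 2, 1, 3, 1, 0, 2]),
     ([2, 1, 1, 3], [1, 2, 1, 3], [1, 2, 1, 3, 1, 2, 0])] := by
  decide +kernel

theorem pumpTable_square_square_zero : PumpTable (squareL true) (squareR true) 0
    ([4, 1, 1, 2], [3, 1, 2, 1], [3, 1, 1, 2])
    [([0, 1, 1, 2], [3, 1, 2, 1], [3, 1, 1, 2]),
     ([1, 0, 3, 1], [2, 1, 3, 1], [2, 1, 1, 3]),
     ([1, 3, 0, 1], [2, 1, 3, 1], [2, 1, 1, 3]),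
     ([1, 2, 3, 0], [2, 1, 3, 1], [2, 1, 1, 3])]
    [([2, 1, 1, 3], [1, 2, 1, 3], [0, 1, 1, 2]),
     ([2, 1, 1, 3], [1, 2, 1, 3], [1, 0, 2, 1]),
     ([2, 1, 1, 3], [1, 2, 1, 3], [1, 2, 0, 1]),
     ([2, 1, 1, 3], [1, 2, 1, 3], [2, 1, 1, 0])] := by
  decide +kernel

theorem pumpTable_square_square_two : PumpTable (squareL true) (squareR true) 2
    ([4, 1, 1, 2], [3, 1, 2, 1], [3, 1, 2, 1, 1, 3])
    [([0, 1, 1, 2], [3, 1, 2, 1], [3, 1, 2, 1, 1, 3]),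
     ([1, 0, 3, 1], [2, 1, 3, 1], [2, 1, 3, 1, 1, 2]),
     ([1, 3, 0, 1], [2, 1, 3, 1], [2, 1, 3, 1, 1, 2]),
     ([1, 2, 3, 0], [2, 1, 3, 1], [2, 1, 3, 1, 1, 2])]
    [([2, 1, 1, 3], [1, 2, 1, 3], [1, 2, 0, 1, 1, 2]),
     ([2, 1, 1, 3], [1, 2, 1, 3], [1, 2, 1, 0, 3, 1]),
     ([2, 1, 1, 3], [1, 2, 1, 3], [1, 2, 1, 3, 0, 1]),
     ([3, 1, 1, 2], [1, 3, 1, 2], [1, 3, 2, 1, 1, 0])] := by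
  decide +kernel

theorem FamilyF1.critical {V : Type*} {G : SimpleGraph V} (hG : FamilyF1 G) :
    IsKPackingVertexCritical 4 G := by
  obtain ⟨x, y, k, l, rfl | rfl | rfl, ⟨f⟩⟩ := hG
  · exact pumpTable_triangle_triangle_zero.critical (k := k) f (leftEnd_triangle x)
      (rightEnd_triangle y) (by decide) (notColorable_pump 3 (by decide +kernel) k)
      colorable_triangleL colorable_triangleR
  · exact pumpTable_triangle_triangle_one.critical f (leftEnd_triangle x)
      (rightEnd_triangle y) (by decide) (notColorable_pump 3 (by decide +kernel) k)
      colorable_triangleL colorable_triangleR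
  · exact pumpTable_triangle_triangle_two.critical f (leftEnd_triangle x)
      (rightEnd_triangle y) (by decide) (notColorable_pump 3 (by decide +kernel) k)
      colorable_triangleL colorable_triangleR

theorem FamilyF2.critical {V : Type*} {G : SimpleGraph V} (hG : FamilyF2 G) :
    IsKPackingVertexCritical 4 G := by
  obtain ⟨x, y, l, hy, rfl | ⟨k, rfl⟩, ⟨f⟩⟩ := hG
  · exact pumpTable_triangle_cherry_zero.critical (k := 0) f (leftEnd_triangle x)
      (rightEnd_cherry hy) (by decide) ((reaches_run _).notColorable (by decide +kernel))
      colorable_triangleL colorable_cherryR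
  · exact pumpTable_triangle_cherry_two.critical f (leftEnd_triangle x)
      (rightEnd_cherry hy) (by decide) (notColorable_pump 3 (by decide +kernel) k)
      colorable_triangleL colorable_cherryR

theorem FamilyF3.critical {V : Type*} {G : SimpleGraph V} (hG : FamilyF3 G) :
    IsKPackingVertexCritical 4 G := by
  obtain ⟨A, hA, x, y, k, hx, hk, ⟨f⟩⟩ := hG
  obtain ⟨k, rfl⟩ := Nat.exists_eq_add_of_le' hk
  exact pumpTable_square_triangle_four.critical (k := k) f (leftEnd_square hA hx)
    (rightEnd_triangle y) (by decide) (notColorable_pump 3 (by decide +kernel) k)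
    colorable_squareL colorable_triangleR

theorem FamilyF5.critical {V : Type*} {G : SimpleGraph V} (hG : FamilyF5 G) :
    IsKPackingVertexCritical 4 G := by
  obtain ⟨A, B, hA, hB, x, y, k, hx, hy, ⟨f⟩⟩ := hG
  rcases Nat.even_or_odd' k with ⟨k, rfl | rfl⟩
  · have e : 2 * (2 * k) = 4 * k + 0 := by ring
    rw [e] at f
    exact pumpTable_square_square_zero.critical f (leftEnd_square hA hx)
      (rightEnd_square hB hy) (by decide) (notColorable_pump 3 (by decide +kernel) k)
      colorable_squareL colorable_squareR
  · have e : 2 * (2 * k + 1) = 4 * k + 2 := by ring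
    rw [e] at f
    exact pumpTable_square_square_two.critical f (leftEnd_square hA hx)
      (rightEnd_square hB hy) (by decide) (notColorable_pump 3 (by decide +kernel) k)
      colorable_squareL colorable_squareR

/-! ### The graphs with three ends -/

/-- Half of the adjacency relation of `treeF4 x v z l m`. -/
def treeArc (x : Fin 3) (v : Fin 2) (z : Fin 3) (l m : ℕ) :
    (((Fin 3 ⊕ Fin 2) ⊕ Fin 3) ⊕ Fin l) ⊕ Fin m →
      (((Fin 3 ⊕ Fin 2) ⊕ Fin 3) ⊕ Fin l) ⊕ Fin m → Prop
  | .inl (.inl (.inl (.inl a))), .inl (.inl (.inl (.inl a'))) => (pathGraph 3).Adj a a'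
  | .inl (.inl (.inl (.inr c))), .inl (.inl (.inl (.inr c'))) => c ≠ v ∧ c' = v
  | .inl (.inl (.inr b)), .inl (.inl (.inr b')) => (pathGraph 3).Adj b b'
  | .inl (.inl (.inl (.inl a))), .inl (.inl (.inl (.inr c))) => l = 0 ∧ a = x ∧ c = v
  | .inl (.inl (.inl (.inl a))), .inl (.inr i) => a = x ∧ (i : ℕ) = 0
  | .inl (.inr i), .inl (.inr j) => (i : ℕ) + 1 = j
  | .inl (.inr i), .inl (.inl (.inl (.inr c))) => c = v ∧ (i : ℕ) + 1 = l
  | .inl (.inl (.inl (.inr c))), .inr i => c = v ∧ (i : ℕ) = 0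
  | .inr i, .inr j => (i : ℕ) + 1 = j
  | .inr i, .inl (.inl (.inr b)) => b = z ∧ (i : ℕ) + 1 = m
  | .inl (.inl (.inl (.inr c))), .inl (.inl (.inr b)) => m = 0 ∧ c = v ∧ b = z
  | _, _ => False

theorem treeF4_adj {x : Fin 3} {v : Fin 2} {z : Fin 3} {l m : ℕ}
    {p q : (((Fin 3 ⊕ Fin 2) ⊕ Fin 3) ⊕ Fin l) ⊕ Fin m} :
    (treeF4 x v z l m).Adj p q ↔ treeArc x v z l m p q ∨ treeArc x v z l m q p := by
  have h1 : (Sum.inl (Sum.inl x) : (Fin 3 ⊕ Fin 2) ⊕ Fin 3) ≠ Sum.inl (Sum.inr v) := by simp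
  have h2 : (Sum.inl (Sum.inl (Sum.inr v)) : ((Fin 3 ⊕ Fin 2) ⊕ Fin 3) ⊕ Fin l) ≠
    Sum.inl (Sum.inr z) := by simp
  have hc : ∀ c c' : Fin 2, (pathGraph 2).Adj c c' ↔ (c ≠ v ∧ c' = v) ∨ (c' ≠ v ∧ c = v) := by
    intro c c'
    rw [pathGraph_adj]
    omega
  rcases p with (((a | c) | b) | i) | i <;> rcases q with (((a' | c') | b') | j) | j <;>
    simp [treeF4, treeArc, subdivide_adj_inl_inl, subdivide_adj_inl_inr,
      subdivide_adj_inr_inr, baseF4, edge_adj, hc, adj_comm]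

/-- The numbering of the vertices of `treeF4 x v z l m`: the first end, the first path, the two
vertices of the path `P₂` (numbered by `g`), the second path, and the second end. -/
def treeIndex {l m : ℕ} (g : Fin 2 → ℕ) :
    (((Fin 3 ⊕ Fin 2) ⊕ Fin 3) ⊕ Fin l) ⊕ Fin m → ℕ
  | .inl (.inl (.inl (.inl a))) => ![0, 2, 1] a
  | .inl (.inr i) => 3 + i
  | .inl (.inl (.inl (.inr c))) => 3 + l + g c
  | .inr i => 3 + l + 2 + i
  | .inl (.inl (.inr b)) => 3 + l + 2 + m + ![1, 0, 2] b

theorem treeIndex_lt {l m : ℕ} {g : Fin 2 → ℕ} (hg : ∀ c, g c < 2)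
    (p : (((Fin 3 ⊕ Fin 2) ⊕ Fin 3) ⊕ Fin l) ⊕ Fin m) : treeIndex g p < l + m + 8 := by
  rcases p with (((a | c) | b) | i) | i
  · fin_cases a <;> simp [treeIndex]
  · have := hg c
    simp only [treeIndex]
    omega
  · fin_cases b <;> simp [treeIndex] <;> omega
  · simp only [treeIndex]
    omega
  · simp only [treeIndex]
    omega

theorem treeIndex_injective {l m : ℕ} {g : Fin 2 → ℕ} (hg : ∀ c, g c < 2)
    (hi : Function.Injective g) : Function.Injective (treeIndex (l := l) (m := m) g) := by
  have h3 : ∀ a : Fin 3, (![0, 2, 1] a : ℕ) < 3 := by decide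
  have i3 : ∀ a a' : Fin 3, (![0, 2, 1] a : ℕ) = ![0, 2, 1] a' → a = a' := by decide
  have j3 : ∀ b b' : Fin 3, (![1, 0, 2] b : ℕ) = ![1, 0, 2] b' → b = b' := by decide
  rintro ((((a | c) | b) | i) | i) ((((a' | c') | b') | j) | j) h <;> simp only [treeIndex] at h
  case inl.inl.inl.inl.inl.inl.inl.inl => rw [i3 a a' h]
  case inl.inl.inl.inr.inl.inl.inl.inr => rw [hi (by omega : g c = g c')]
  case inl.inl.inr.inl.inl.inr => rw [j3 b b' (by omega)]
  case inl.inr.inl.inr => rw [Fin.ext (by omega : (i : ℕ) = j)]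
  case inr.inr => rw [Fin.ext (by omega : (i : ℕ) = j)]
  all_goals
    first
    | have := h3 a
      omega
    | have := h3 a'
      omega
    | have := hg c
      omega
    | have := hg c'
      omega
    | omega

theorem exists_treeIndex_eq {l m : ℕ} {g : Fin 2 → ℕ} (hs : ∀ i < 2, ∃ c, g c = i) {i : ℕ}
    (hi : i < l + m + 8) :
    ∃ p : (((Fin 3 ⊕ Fin 2) ⊕ Fin 3) ⊕ Fin l) ⊕ Fin m, treeIndex g p = i := by
  have h3 : ∀ i < 3, ∃ a : Fin 3, (![0, 2, 1] a : ℕ) = i := by decide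
  have j3 : ∀ i < 3, ∃ a : Fin 3, (![1, 0, 2] a : ℕ) = i := by decide
  by_cases h1 : i < 3
  · obtain ⟨a, ha⟩ := h3 i h1
    exact ⟨.inl (.inl (.inl (.inl a))), ha⟩
  by_cases h2 : i < 3 + l
  · exact ⟨.inl (.inr ⟨i - 3, by omega⟩), by simp only [treeIndex]; omega⟩
  by_cases h4 : i < 3 + l + 2
  · obtain ⟨c, hc⟩ := hs (i - 3 - l) (by omega)
    exact ⟨.inl (.inl (.inl (.inr c))), by simp only [treeIndex]; omega⟩
  by_cases h5 : i < 3 + l + 2 + m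
  · exact ⟨.inr ⟨i - 3 - l - 2, by omega⟩, by simp only [treeIndex]; omega⟩
  · obtain ⟨b, hb⟩ := j3 (i - 3 - l - 2 - m) (by omega)
    exact ⟨.inl (.inl (.inr b)), by simp only [treeIndex]; omega⟩

/-- Two paths, of `a` and of `b` vertices, between the two ends and a word `t` in the middle. -/
def treeWord (a b : ℕ) (t : List Letter) : List Letter :=
  cherryL ++ (pathWord a ++ (t ++ (pathWord b ++ cherryR)))

/-- The vertices `y_{l-1}`, `y_l`, `v₁`, `v` of the middle part; `c` says whether `v₁` is adjacent
to `y_{l-1}`. -/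
def middleL (c : Bool) : List Letter := [(true, c), (false, true), (true, false), (true, false)]

/-- The vertices `v`, `v₁`, `w₁`, `w₂` of the middle part, where `v₁` is adjacent to `w₂`. -/
def middleR : List Letter := [(true, true), (false, true), (true, false), (true, false)]

theorem length_middleL (c : Bool) : (middleL c).length = 4 := rfl

theorem length_middleR : middleR.length = 4 := rfl

section TreeWord

variable {a b i j : ℕ} {t : List Letter}

theorem length_treeWord (ht : t.length = 4) : (treeWord a b t).length = a + b + 10 := by
  simp [treeWord, cherryL, cherryR, pathWord, ht]
  omega

theorem length_cherryL : cherryL.length = 3 := rfl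

theorem length_pathWord (l : ℕ) : (pathWord l).length = l := by simp [pathWord]

theorem fadj_treeWord_left (hi : i < 3) : fadj (treeWord a b t) i j ↔ fadj cherryL i j :=
  fadj_append_left hi

theorem fadj_treeWord_middle (hi : i < t.length) :
    fadj (treeWord a b t) (3 + a + i) (3 + a + j) ↔ fadj t i j := by
  simp only [treeWord, add_assoc]
  rw [fadj_append_right length_cherryL, fadj_append_right (length_pathWord a), fadj_append_left hi]

theorem fadj_treeWord_right {n : ℕ} (ht : t.length = n) :
    fadj (treeWord a b t) (3 + a + n + b + i) (3 + a + n + b + j) ↔ fadj cherryR i j := by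
  simp only [treeWord, add_assoc]
  rw [fadj_append_right length_cherryL, fadj_append_right (length_pathWord a),
    fadj_append_right ht, fadj_append_right (length_pathWord b)]

theorem fadj_pathWord_append {l : ℕ} {w : List Letter} (hi : i < l) :
    fadj (pathWord l ++ w) i j ↔ j = i + 1 := by
  rw [fadj_append_left (by rwa [length_pathWord]), fadj, getD_pathWord hi]
  simp

theorem fadj_le {w : List Letter} (h : fadj w i j) : i ≤ j := by
  rcases h with h | h <;> omega

theorem fadj_treeWord_path_left (hi : i < a) :
    fadj (treeWord a b t) (3 + i) j ↔ j = 3 + i + 1 := by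
  have key : ∀ j, fadj (treeWord a b t) (3 + i) (3 + j) ↔ j = i + 1 := fun j => by
    rw [treeWord, fadj_append_right length_cherryL, fadj_pathWord_append hi]
  constructor
  · intro h
    obtain ⟨j, rfl⟩ := Nat.exists_eq_add_of_le (le_trans (Nat.le_add_right 3 i) (fadj_le h))
    have := (key j).1 h
    omega
  · rintro rfl
    exact (key (i + 1)).2 rfl

theorem fadj_treeWord_path_right {n : ℕ} (ht : t.length = n) (hi : i < b) :
    fadj (treeWord a b t) (3 + a + n + i) j ↔ j = 3 + a + n + i + 1 := by
  have key : ∀ j, fadj (treeWord a b t) (3 + a + n + i) (3 + a + n + j) ↔ j = i + 1 := fun j => by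
    simp only [treeWord, add_assoc]
    rw [fadj_append_right length_cherryL, fadj_append_right (length_pathWord a),
      fadj_append_right ht, fadj_pathWord_append hi]
  constructor
  · intro h
    obtain ⟨j, rfl⟩ := Nat.exists_eq_add_of_le (le_trans (Nat.le_add_right (3 + a + n) i) (fadj_le h))
    have := (key j).1 h
    omega
  · rintro rfl
    exact (key (i + 1)).2 rfl

end TreeWord

/-- The graph `treeF4` contains the graph of a word: the next neighbors of an index are the numbers
of neighbors of the vertex. -/
theorem treeF4_lower {v v₁ : Fin 2} (hv : v₁ ≠ v) {l m a : ℕ} (hl : l = a + 2) {g : Fin 2 → ℕ}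
    (hgv : g v = 1) (hgv₁ : g v₁ = 0)
    (p q : (((Fin 3 ⊕ Fin 2) ⊕ Fin 3) ⊕ Fin l) ⊕ Fin m)
    (h : wadj (treeWord a m (middleL false)) (treeIndex g p) (treeIndex g q)) :
    (treeF4 1 v 1 l m).Adj p q := by
  subst hl
  have hc : ∀ c, c = v ∨ c = v₁ := by omega
  have inj : Function.Injective (treeIndex (l := a + 2) (m := m) g) := by
    refine treeIndex_injective (fun c => ?_) fun c c' h => ?_
    · rcases hc c with rfl | rfl <;> omega
    · rcases hc c with rfl | rfl <;> rcases hc c' with rfl | rfl <;> first | rfl | omega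
  suffices H : ∀ p j, fadj (treeWord a m (middleL false)) (treeIndex g p) j →
      ∃ q, treeIndex g q = j ∧ (treeF4 1 v 1 (a + 2) m).Adj p q by
    rcases wadj_iff.1 h with h | h
    · obtain ⟨q', h1, h2⟩ := H p _ h
      rwa [inj h1] at h2
    · obtain ⟨q', h1, h2⟩ := H q _ h
      rw [inj h1] at h2
      exact h2.symm
  -- the successor of the vertex `v` or of a vertex of the second path
  have hnext : ∀ i, i ≤ m → ∀ p : (((Fin 3 ⊕ Fin 2) ⊕ Fin 3) ⊕ Fin (a + 2)) ⊕ Fin m,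
      (i = 0 ∧ p = .inl (.inl (.inl (.inr v)))) ∨ (∃ j : Fin m, (j : ℕ) + 1 = i ∧ p = .inr j) →
      ∃ q, treeIndex g q = 3 + (a + 2) + 2 + i ∧ (treeF4 1 v 1 (a + 2) m).Adj p q := by
    intro i hi p hp
    by_cases him : i < m
    · refine ⟨.inr ⟨i, him⟩, rfl, ?_⟩
      rw [treeF4_adj]
      rcases hp with ⟨rfl, rfl⟩ | ⟨j, hj, rfl⟩
      · exact Or.inl ⟨rfl, rfl⟩
      · exact Or.inl hj
    · refine ⟨.inl (.inl (.inr 1)), by simp [treeIndex]; omega, ?_⟩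
      rw [treeF4_adj]
      rcases hp with ⟨rfl, rfl⟩ | ⟨j, hj, rfl⟩
      · exact Or.inl ⟨by omega, rfl, rfl⟩
      · exact Or.inl ⟨rfl, by omega⟩
  rintro ((((x | c) | b) | i) | i) j h <;> simp only [treeIndex] at h
  · have hx : ∀ x : Fin 3, (![0, 2, 1] x : ℕ) < 3 := by decide
    rw [fadj_treeWord_left (hx x)] at h
    have key : j = if x = 1 then 3 else 2 := by
      fin_cases x <;> simp [fadj, cherryL] at h ⊢ <;> omega
    by_cases h1 : x = 1
    · refine ⟨.inl (.inr ⟨0, by omega⟩), by simp [treeIndex, key, h1], ?_⟩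
      rw [treeF4_adj]
      exact Or.inl ⟨h1, rfl⟩
    · refine ⟨.inl (.inl (.inl (.inl 1))), by simp [treeIndex, key, h1], ?_⟩
      rw [treeF4_adj]
      refine Or.inl (pathGraph_adj.2 ?_)
      simp
      omega
  · obtain ⟨j, rfl⟩ := Nat.exists_eq_add_of_le
      (le_trans (by omega : 3 + a ≤ 3 + (a + 2) + g c) (fadj_le h))
    rcases hc c with rfl | rfl
    · rw [hgv, show 3 + (a + 2) + 1 = 3 + a + 3 by ring,
        fadj_treeWord_middle (by simp [middleL])] at h
      have hj : j = 4 := by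
        simp [fadj, middleL] at h
        omega
      obtain ⟨q, h1, h2⟩ := hnext 0 (by omega) _ (Or.inl ⟨rfl, rfl⟩)
      exact ⟨q, by omega, h2⟩
    · rw [hgv₁, show 3 + (a + 2) + 0 = 3 + a + 2 by ring,
        fadj_treeWord_middle (by simp [middleL])] at h
      have hj : j = 3 := by
        simp [fadj, middleL] at h
        omega
      refine ⟨.inl (.inl (.inl (.inr v))), by simp only [treeIndex]; omega, ?_⟩
      rw [treeF4_adj]
      exact Or.inl ⟨hv, rfl⟩
  · obtain ⟨j, rfl⟩ := Nat.exists_eq_add_of_le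
      (le_trans (by omega : 3 + a + 4 + m ≤ _) (fadj_le h))
    rw [show 3 + (a + 2) + 2 + m = 3 + a + 4 + m by ring, fadj_treeWord_right (length_middleL _)] at h
    have hb : b = 1 ∧ (j = 1 ∨ j = 2) := by
      fin_cases b <;> simp [fadj, cherryR] at h ⊢
      omega
    obtain ⟨rfl, hj | hj⟩ := hb
    · refine ⟨.inl (.inl (.inr 0)), by simp [treeIndex]; omega, ?_⟩
      rw [treeF4_adj]
      exact Or.inl (pathGraph_adj.2 (by simp))
    · refine ⟨.inl (.inl (.inr 2)), by simp [treeIndex]; omega, ?_⟩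
      rw [treeF4_adj]
      exact Or.inl (pathGraph_adj.2 (by simp))
  · have hstep : j = 3 + i + 1 ∧ (i : ℕ) < a + 1 ∨ (i : ℕ) = a + 1 ∧ j = 3 + a + 3 := by
      by_cases hi : (i : ℕ) < a
      · rw [fadj_treeWord_path_left hi] at h
        omega
      · obtain ⟨j, rfl⟩ := Nat.exists_eq_add_of_le
          (le_trans (by omega : 3 + a ≤ 3 + (i : ℕ)) (fadj_le h))
        have hi' : (i : ℕ) = a ∨ (i : ℕ) = a + 1 := by omega
        rcases hi' with hi | hi
        · have h' : fadj (middleL false) 0 j := (fadj_treeWord_middle (by simp [middleL])).1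
            (show fadj _ (3 + a + 0) _ by rwa [hi] at h)
          simp [fadj, middleL] at h'
          omega
        · have h' : fadj (middleL false) 1 j := (fadj_treeWord_middle (by simp [middleL])).1
            (show fadj _ (3 + a + 1) _ by rwa [hi, ← add_assoc] at h)
          simp [fadj, middleL] at h'
          omega
    rcases hstep with ⟨h1, h2⟩ | ⟨h1, h2⟩
    · refine ⟨.inl (.inr ⟨i + 1, by omega⟩), by simp only [treeIndex]; omega, ?_⟩
      rw [treeF4_adj]
      exact Or.inl rfl
    · refine ⟨.inl (.inl (.inl (.inr v))), by simp only [treeIndex]; omega, ?_⟩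
      rw [treeF4_adj]
      exact Or.inl ⟨rfl, by omega⟩
  · rw [show 3 + (a + 2) + 2 = 3 + a + 4 by ring, fadj_treeWord_path_right (length_middleL _) i.2] at h
    obtain ⟨q, h1, h2⟩ := hnext (i + 1) (by omega) _ (Or.inr ⟨i, rfl, rfl⟩)
    exact ⟨q, by omega, h2⟩

theorem wadj_treeWord_left {a b : ℕ} {t : List Letter} {x y : Fin 3}
    (h : (pathGraph 3).Adj x y) : wadj (treeWord a b t) (![0, 2, 1] x) (![0, 2, 1] y) := by
  have hx : ∀ x : Fin 3, (![0, 2, 1] x : ℕ) < 3 := by decide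
  rw [wadj_iff, fadj_treeWord_left (hx x), fadj_treeWord_left (hx y), ← wadj_iff]
  rw [pathGraph_adj] at h
  revert x y
  decide

theorem wadj_treeWord_right {a b n : ℕ} {t : List Letter} (ht : t.length = n) {x y : Fin 3}
    (h : (pathGraph 3).Adj x y) : wadj (treeWord a b t) (3 + a + n + b + ![1, 0, 2] x)
      (3 + a + n + b + ![1, 0, 2] y) := by
  rw [wadj_iff, fadj_treeWord_right ht, fadj_treeWord_right ht, ← wadj_iff]
  rw [pathGraph_adj] at h
  revert x y
  decide

theorem fadj_of_eq {w : List Letter} {i j i' j' : ℕ} (h : fadj w i' j') (hi : i = i') (hj : j = j') :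
    fadj w i j := by
  rwa [hi, hj]

/-- The graph `treeF4`, also with the edge from `v₁` to the first path, lies in the graph of a word.
-/
theorem treeF4_upper_left {v v₁ : Fin 2} (hv : v₁ ≠ v) {l m a : ℕ} (hl : l = a + 2) {g : Fin 2 → ℕ}
    (hgv : g v = 1) (hgv₁ : g v₁ = 0) :
    (∀ p q, (treeF4 1 v 1 l m).Adj p q →
      wadj (treeWord a m (middleL true)) (treeIndex g p) (treeIndex g q)) ∧
    ∀ j : Fin l, (j : ℕ) = a → fadj (treeWord a m (middleL true))
      (treeIndex (l := l) (m := m) g (.inl (.inr j)))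
      (treeIndex (l := l) (m := m) g (.inl (.inl (.inl (.inr v₁))))) := by
  subst hl
  have hm : ∀ i j, i < 4 → fadj (middleL true) i j →
      fadj (treeWord a m (middleL true)) (3 + a + i) (3 + a + j) :=
    fun i j hi h => (fadj_treeWord_middle hi).2 h
  have m01 := hm 0 1 (by simp) (Or.inl ⟨rfl, rfl⟩)
  have m02 := hm 0 2 (by simp) (Or.inr ⟨rfl, rfl⟩)
  have m13 := hm 1 3 (by simp) (Or.inr ⟨rfl, rfl⟩)
  have m23 := hm 2 3 (by simp) (Or.inl ⟨rfl, rfl⟩)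
  have m34 := hm 3 4 (by simp) (Or.inl ⟨rfl, rfl⟩)
  have hX : fadj (treeWord a m (middleL true)) 2 3 :=
    (fadj_treeWord_left (by simp)).2 (Or.inl ⟨rfl, rfl⟩)
  have hR : ∀ i, i < m → fadj (treeWord a m (middleL true)) (3 + a + 4 + i) (3 + a + 4 + i + 1) :=
    fun i hi => (fadj_treeWord_path_right (length_middleL _) hi).2 rfl
  refine ⟨?_, fun j hj => fadj_of_eq m02 ?_ ?_⟩
  · suffices H : ∀ p q, treeArc 1 v 1 (a + 2) m p q →
        wadj (treeWord a m (middleL true)) (treeIndex g p) (treeIndex g q) by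
      intro p q h
      rcases treeF4_adj.1 h with h | h
      · exact H p q h
      · exact wadj_iff.2 (wadj_iff.1 (H q p h)).symm
    rintro ((((x | c) | b) | i) | i) ((((x' | c') | b') | j) | j) h <;>
      simp only [treeArc] at h <;> simp only [treeIndex]
    case inl.inl.inl.inl.inl.inl.inl.inl => exact wadj_treeWord_left h
    case refine_1.inl.inl.inr.inl.inl.inr =>
      exact wadj_treeWord_right (length_middleL _) h
    all_goals refine wadj_iff.2 (Or.inl ?_)
    case inl.inl.inl.inl.inl.inl.inl.inr => omega
    case inl.inl.inl.inl.inl.inr =>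
      obtain ⟨rfl, h⟩ := h
      exact fadj_of_eq hX rfl (by omega)
    case inl.inl.inl.inr.inl.inl.inl.inr =>
      obtain ⟨h, rfl⟩ := h
      obtain rfl : c = v₁ := by omega
      exact fadj_of_eq m23 (by omega) (by omega)
    case inl.inl.inl.inr.inl.inl.inr =>
      obtain ⟨rfl, rfl, rfl⟩ := h
      exact fadj_of_eq m34 (by omega) (by simp; omega)
    case inl.inl.inl.inr.inr =>
      obtain ⟨rfl, h⟩ := h
      exact fadj_of_eq m34 (by omega) (by omega)
    case inl.inr.inl.inl.inl.inr =>
      obtain ⟨rfl, h⟩ := h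
      exact fadj_of_eq m13 (by omega) (by omega)
    case inl.inr.inl.inr =>
      by_cases hi : (i : ℕ) < a
      · exact (fadj_treeWord_path_left hi).2 (by omega)
      · exact fadj_of_eq m01 (by omega) (by omega)
    case inr.inl.inl.inr =>
      obtain ⟨rfl, h⟩ := h
      exact fadj_of_eq (hR i i.2) (by omega) (by simp; omega)
    case inr.inr => exact fadj_of_eq (hR i i.2) (by omega) (by omega)
  · simp only [treeIndex]
    omega
  · simp only [treeIndex]
    omega

/-- The graph `treeF4`, also with the edge from `v₁` to the second path, lies in the graph of a
word. -/
theorem treeF4_upper_right {v v₁ : Fin 2} (hv : v₁ ≠ v) {l m b : ℕ} (hm : m = b + 2)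
    {g : Fin 2 → ℕ} (hgv : g v = 0) (hgv₁ : g v₁ = 1) :
    (∀ p q, (treeF4 1 v 1 l m).Adj p q →
      wadj (treeWord l b middleR) (treeIndex g p) (treeIndex g q)) ∧
    ∀ j : Fin m, (j : ℕ) = 1 → fadj (treeWord l b middleR)
      (treeIndex (l := l) (m := m) g (.inl (.inl (.inl (.inr v₁)))))
      (treeIndex (l := l) (m := m) g (.inr j)) := by
  subst hm
  have hm : ∀ i j, i < 4 → fadj middleR i j →
      fadj (treeWord l b middleR) (3 + l + i) (3 + l + j) :=
    fun i j hi h => (fadj_treeWord_middle hi).2 h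
  have m01 := hm 0 1 (by simp) (Or.inl ⟨rfl, rfl⟩)
  have m02 := hm 0 2 (by simp) (Or.inr ⟨rfl, rfl⟩)
  have m13 := hm 1 3 (by simp) (Or.inr ⟨rfl, rfl⟩)
  have m23 := hm 2 3 (by simp) (Or.inl ⟨rfl, rfl⟩)
  have m34 := hm 3 4 (by simp) (Or.inl ⟨rfl, rfl⟩)
  have hX : fadj (treeWord l b middleR) 2 3 :=
    (fadj_treeWord_left (by simp)).2 (Or.inl ⟨rfl, rfl⟩)
  have hR : ∀ i, i < b → fadj (treeWord l b middleR) (3 + l + 4 + i) (3 + l + 4 + i + 1) :=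
    fun i hi => (fadj_treeWord_path_right length_middleR hi).2 rfl
  have hR' : ∀ i, i < b + 2 → fadj (treeWord l b middleR) (3 + l + 2 + i) (3 + l + 2 + i + 1) := by
    intro i hi
    match i with
    | 0 => exact m23
    | 1 => exact m34
    | i + 2 => exact fadj_of_eq (hR i (by omega)) (by omega) (by omega)
  refine ⟨?_, fun j hj => fadj_of_eq m13 ?_ ?_⟩
  · suffices H : ∀ p q, treeArc 1 v 1 l (b + 2) p q →
        wadj (treeWord l b middleR) (treeIndex g p) (treeIndex g q) by
      intro p q h
      rcases treeF4_adj.1 h with h | h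
      · exact H p q h
      · exact wadj_iff.2 (wadj_iff.1 (H q p h)).symm
    rintro ((((x | c) | z) | i) | i) ((((x' | c') | z') | j) | j) h <;>
      simp only [treeArc] at h <;> simp only [treeIndex]
    case inl.inl.inl.inl.inl.inl.inl.inl => exact wadj_treeWord_left h
    case refine_1.inl.inl.inr.inl.inl.inr =>
      have := wadj_treeWord_right (a := l) (b := b) length_middleR h
      rwa [show 3 + l + 4 + b = 3 + l + 2 + (b + 2) by ring] at this
    case inl.inl.inl.inr.inl.inl.inl.inr =>
      obtain ⟨h, rfl⟩ := h
      obtain rfl : c = v₁ := by omega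
      exact wadj_iff.2 (Or.inr (fadj_of_eq m01 (by omega) (by omega)))
    all_goals refine wadj_iff.2 (Or.inl ?_)
    case inl.inl.inl.inl.inl.inl.inl.inr =>
      obtain ⟨rfl, rfl, rfl⟩ := h
      exact fadj_of_eq hX rfl (by omega)
    case inl.inl.inl.inl.inl.inr =>
      obtain ⟨rfl, h⟩ := h
      exact fadj_of_eq hX rfl (by omega)
    case inl.inl.inl.inr.inl.inl.inr => omega
    case inl.inl.inl.inr.inr =>
      obtain ⟨rfl, h⟩ := h
      exact fadj_of_eq m02 (by omega) (by omega)
    case inl.inr.inl.inl.inl.inr =>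
      obtain ⟨rfl, h⟩ := h
      exact (fadj_treeWord_path_left i.2).2 (by omega)
    case inl.inr.inl.inr => exact (fadj_treeWord_path_left i.2).2 (by omega)
    case inr.inl.inl.inr =>
      obtain ⟨rfl, h⟩ := h
      exact fadj_of_eq (hR' i i.2) rfl (by simp; omega)
    case inr.inr => exact fadj_of_eq (hR' i i.2) rfl (by omega)
  · simp only [treeIndex]
    omega
  · simp only [treeIndex]
    omega

/-! ### Colorings with two paths of variable length -/

/-- The analogue of `PumpRow` for words with two paths of variable length. -/
def PumpRow₂ (u y z : List Letter) (c : List ℕ × List ℕ × List ℕ × List ℕ × List ℕ) : Prop :=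
  ((u.length = c.1.length ∧ y.length = c.2.2.1.length ∧ z.length = c.2.2.2.2.length) ∧
    (c.2.1.length = 4 ∧ c.2.2.2.1.length = 4) ∧
    AllProper (paint (pathWord 4) c.2.1) ∧ AllProper (paint (pathWord 4) c.2.2.2.1)) ∧
  (valid (rep 3 (paint (pathWord 4) c.2.1)) ∧ valid (rep 3 (paint (pathWord 4) c.2.2.2.1))) ∧
  ∀ k < 3, ∀ k' < 3, valid (paint u c.1 ++ (rep k (paint (pathWord 4) c.2.1) ++
    (paint y c.2.2.1 ++ (rep k' (paint (pathWord 4) c.2.2.2.1) ++ paint z c.2.2.2.2))))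

instance (u y z : List Letter) (c : List ℕ × List ℕ × List ℕ × List ℕ × List ℕ) :
    Decidable (PumpRow₂ u y z c) :=
  inferInstanceAs (Decidable (_ ∧ _))

section PumpRow₂

variable {u y z : List Letter} {c : List ℕ × List ℕ × List ℕ × List ℕ × List ℕ}

theorem PumpRow₂.map_fst (h : PumpRow₂ u y z c) (k k' : ℕ) :
    (paint u c.1 ++ (rep k (paint (pathWord 4) c.2.1) ++ (paint y c.2.2.1 ++
      (rep k' (paint (pathWord 4) c.2.2.2.1) ++ paint z c.2.2.2.2)))).map Prod.fst =
      u ++ (rep k (pathWord 4) ++ (y ++ (rep k' (pathWord 4) ++ z))) := by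
  obtain ⟨⟨⟨h1, h2, h3⟩, ⟨h4, h5⟩, -⟩, -⟩ := h
  simp only [List.map_append, map_rep]
  rw [map_fst_paint h1, map_fst_paint h2, map_fst_paint h3,
    map_fst_paint (by simp [pathWord, h4]), map_fst_paint (by simp [pathWord, h5])]

theorem PumpRow₂.valid (h : PumpRow₂ u y z c) (k k' : ℕ) :
    PackingColoring.valid (paint u c.1 ++ (rep k (paint (pathWord 4) c.2.1) ++ (paint y c.2.2.1 ++
      (rep k' (paint (pathWord 4) c.2.2.2.1) ++ paint z c.2.2.2.2)))) := by
  obtain ⟨⟨-, ⟨h4, h5⟩, -⟩, ⟨h6, h7⟩, hv⟩ := h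
  refine valid_pump (by simp [pathWord, h4]) h6 (fun k hk => ?_) k
  have := valid_pump (x := paint u c.1 ++ (rep k (paint (pathWord 4) c.2.1) ++ paint y c.2.2.1))
    (m := paint (pathWord 4) c.2.2.2.1) (z := paint z c.2.2.2.2) (by simp [pathWord, h5]) h7
    (fun k' hk' => by simpa only [List.append_assoc] using hv k hk k' hk') k'
  simpa only [List.append_assoc] using this

theorem PumpRow₂.colorable
    (h : PumpRow₂ u y z c ∧ AllProper (paint u c.1) ∧ AllProper (paint y c.2.2.1) ∧
      AllProper (paint z c.2.2.2.2)) (k k' : ℕ) :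
    Colorable (u ++ (rep k (pathWord 4) ++ (y ++ (rep k' (pathWord 4) ++ z)))) :=
  ⟨_, h.1.map_fst k k', h.1.valid k k', h.2.1.append ((h.1.1.2.2.1.rep k).append
    (h.2.2.1.append ((h.1.1.2.2.2.rep k').append h.2.2.2)))⟩

theorem PumpRow₂.colorableOff_left {i : ℕ}
    (h : PumpRow₂ u y z c ∧ ProperOff (paint u c.1) i ∧ AllProper (paint y c.2.2.1) ∧
      AllProper (paint z c.2.2.2.2)) (k k' : ℕ) :
    ColorableOff (u ++ (rep k (pathWord 4) ++ (y ++ (rep k' (pathWord 4) ++ z)))) i :=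
  colorableOff_of_properOff (h.1.map_fst k k') (h.1.valid k k') (h.2.1.append_left
    ((h.1.1.2.2.1.rep k).append (h.2.2.1.append ((h.1.1.2.2.2.rep k').append h.2.2.2))))

theorem PumpRow₂.colorableOff_middle {i : ℕ}
    (h : PumpRow₂ u y z c ∧ AllProper (paint u c.1) ∧ ProperOff (paint y c.2.2.1) i ∧
      AllProper (paint z c.2.2.2.2)) (k k' : ℕ) :
    ColorableOff (u ++ (rep k (pathWord 4) ++ (y ++ (rep k' (pathWord 4) ++ z))))
      (u.length + (4 * k + i)) := by
  obtain ⟨⟨⟨h1, -⟩, ⟨h4, -⟩, h6, h7⟩, -⟩ := h.1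
  refine colorableOff_of_properOff (h.1.map_fst k k') (h.1.valid k k')
    (ProperOff.append_right (by simp [h1]) h.2.1 (ProperOff.append_right ?_ (h6.rep k)
      (h.2.2.1.append_left ((h7.rep k').append h.2.2.2))))
  simp [length_rep, pathWord, h4, mul_comm]

theorem PumpRow₂.colorableOff_right {i : ℕ}
    (h : PumpRow₂ u y z c ∧ AllProper (paint u c.1) ∧ AllProper (paint y c.2.2.1) ∧
      ProperOff (paint z c.2.2.2.2) i) (k k' : ℕ) :
    ColorableOff (u ++ (rep k (pathWord 4) ++ (y ++ (rep k' (pathWord 4) ++ z))))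
      (u.length + (4 * k + (y.length + (4 * k' + i)))) := by
  obtain ⟨⟨⟨h1, h2, -⟩, ⟨h4, h5⟩, h6, h7⟩, -⟩ := h.1
  refine colorableOff_of_properOff (h.1.map_fst k k') (h.1.valid k k')
    (ProperOff.append_right (by simp [h1]) h.2.1 (ProperOff.append_right ?_ (h6.rep k)
      (ProperOff.append_right (by simp [h2]) h.2.2.1
        (ProperOff.append_right ?_ (h7.rep k') h.2.2.2))))
  · simp [length_rep, pathWord, h4, mul_comm]
  · simp [length_rep, pathWord, h5, mul_comm]

theorem PumpRow₂.colorableFour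
    (h : PumpRow₂ u y z c ∧ (ProperOff (paint u c.1) 0 ∧ 0 < (paint u c.1).length ∧
      col (paint u c.1) 0 = 4) ∧ AllProper (paint y c.2.2.1) ∧ AllProper (paint z c.2.2.2.2))
    (k k' : ℕ) :
    ColorableFour (u ++ (rep k (pathWord 4) ++ (y ++ (rep k' (pathWord 4) ++ z)))) := by
  refine ⟨_, h.1.map_fst k k', h.1.valid k k', ?_, ?_⟩
  · rw [col_append, if_pos h.2.1.2.1, h.2.1.2.2]
  · rw [← h.1.map_fst k k', List.length_map]
    exact h.2.1.1.append_left ((h.1.1.2.2.1.rep k).append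
      (h.2.2.1.append ((h.1.1.2.2.2.rep k').append h.2.2.2)))

end PumpRow₂

/-- Colorings of `treeWord (4 * k + r) (4 * k' + r) t`, with the color `4` at the vertex `0` for
`c`, and with one vertex of the first end, of the middle part, or of the second end deleted for the
members of the lists `cL`, `cM`, and `cR`. -/
def PumpTable₂ (r : ℕ) (t : List Letter) (c : List ℕ × List ℕ × List ℕ × List ℕ × List ℕ)
    (cL cM cR : List (List ℕ × List ℕ × List ℕ × List ℕ × List ℕ)) : Prop :=
  (PumpRow₂ cherryL (pathWord r ++ t) (pathWord r ++ cherryR) c ∧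
    (ProperOff (paint cherryL c.1) 0 ∧ 0 < (paint cherryL c.1).length ∧
      col (paint cherryL c.1) 0 = 4) ∧
    AllProper (paint (pathWord r ++ t) c.2.2.1) ∧
    AllProper (paint (pathWord r ++ cherryR) c.2.2.2.2)) ∧
  (∀ i < 3, PumpRow₂ cherryL (pathWord r ++ t) (pathWord r ++ cherryR) (cL.getD i c) ∧
    ProperOff (paint cherryL (cL.getD i c).1) i ∧
    AllProper (paint (pathWord r ++ t) (cL.getD i c).2.2.1) ∧
    AllProper (paint (pathWord r ++ cherryR) (cL.getD i c).2.2.2.2)) ∧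
  (∀ i < 4, PumpRow₂ cherryL (pathWord r ++ t) (pathWord r ++ cherryR) (cM.getD i c) ∧
    AllProper (paint cherryL (cM.getD i c).1) ∧
    ProperOff (paint (pathWord r ++ t) (cM.getD i c).2.2.1) (r + i) ∧
    AllProper (paint (pathWord r ++ cherryR) (cM.getD i c).2.2.2.2)) ∧
  ∀ i < 3, PumpRow₂ cherryL (pathWord r ++ t) (pathWord r ++ cherryR) (cR.getD i c) ∧
    AllProper (paint cherryL (cR.getD i c).1) ∧
    AllProper (paint (pathWord r ++ t) (cR.getD i c).2.2.1) ∧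
    ProperOff (paint (pathWord r ++ cherryR) (cR.getD i c).2.2.2.2) (r + i)

instance (r : ℕ) (t : List Letter) (c : List ℕ × List ℕ × List ℕ × List ℕ × List ℕ)
    (cL cM cR : List (List ℕ × List ℕ × List ℕ × List ℕ × List ℕ)) :
    Decidable (PumpTable₂ r t c cL cM cR) :=
  inferInstanceAs (Decidable (_ ∧ _))

theorem treeWord_eq (k k' r : ℕ) (t : List Letter) :
    treeWord (4 * k + r) (4 * k' + r) t = cherryL ++ (rep k (pathWord 4) ++
      ((pathWord r ++ t) ++ (rep k' (pathWord 4) ++ (pathWord r ++ cherryR)))) := by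
  simp only [treeWord, pathWord_mul_add, List.append_assoc]

/-- The piece before a deleted vertex of the second path is colorable. -/
theorem colorable_tree_left {r : ℕ} {t : List Letter} {x m y m' : List ℕ}
    (h : ∀ s < 4, PumpRow₂ cherryL (pathWord r ++ t) (pathWord s) (x, m, y, m', m'.take s) ∧
      AllProper (paint cherryL x) ∧ AllProper (paint (pathWord r ++ t) y) ∧
      AllProper (paint (pathWord s) (m'.take s))) (k j : ℕ) :
    Colorable (cherryL ++ (pathWord (4 * k + r) ++ (t ++ pathWord j))) := by
  have := PumpRow₂.colorable (h (j % 4) (Nat.mod_lt _ (by norm_num))) k (j / 4)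
  rw [← Nat.div_add_mod j 4, pathWord_mul_add, pathWord_mul_add]
  simpa only [List.append_assoc] using this

/-- The piece after a deleted vertex of the first path is colorable. -/
theorem colorable_tree_right {r : ℕ} {t : List Letter} {m y m' z : List ℕ}
    (h : ∀ s < 4, PumpRow₂ (pathWord s) t (pathWord r ++ cherryR) (m.drop (4 - s), m, y, m', z) ∧
      AllProper (paint (pathWord s) (m.drop (4 - s))) ∧ AllProper (paint t y) ∧
      AllProper (paint (pathWord r ++ cherryR) z)) (j k : ℕ) :
    Colorable (pathWord j ++ (t ++ (pathWord (4 * k + r) ++ cherryR))) := by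
  have := PumpRow₂.colorable (h (j % 4) (Nat.mod_lt _ (by norm_num))) (j / 4) k
  rw [← Nat.div_add_mod j 4, pathWord_mul_add k, pathWord_add_mul]
  simpa only [List.append_assoc] using this

theorem PumpTable₂.colorableOff {r : ℕ} {t : List Letter}
    {c : List ℕ × List ℕ × List ℕ × List ℕ × List ℕ}
    {cL cM cR : List (List ℕ × List ℕ × List ℕ × List ℕ × List ℕ)}
    (h : PumpTable₂ r t c cL cM cR) (ht : t.length = 4 ∧ Exits t)
    (tL : ∀ k j, Colorable (cherryL ++ (pathWord (4 * k + r) ++ (t ++ pathWord j))))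
    (tR : ∀ j k, Colorable (pathWord j ++ (t ++ (pathWord (4 * k + r) ++ cherryR))))
    (k k' : ℕ) : ∀ i < (treeWord (4 * k + r) (4 * k' + r) t).length,
      ColorableOff (treeWord (4 * k + r) (4 * k' + r) t) i := by
  intro i hi
  obtain ⟨ht, hx⟩ := ht
  rw [length_treeWord ht] at hi
  have hy : (pathWord r ++ t).length = r + 4 := by simp [length_pathWord, ht]
  by_cases h1 : i < 3
  · rw [treeWord_eq]
    exact PumpRow₂.colorableOff_left (h.2.1 i h1) k k'
  obtain ⟨i, rfl⟩ := Nat.exists_eq_add_of_le (not_lt.1 h1)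
  by_cases h2 : i < 4 * k + r
  · obtain ⟨j, hj⟩ : ∃ j, 4 * k + r = i + (1 + j) := ⟨4 * k + r - i - 1, by omega⟩
    have := colorableOff_cut (true, false) (colorable_cherryL i) (tR j k')
      (getD_append_pathWord (by decide) i)
    rw [treeWord, hj, pathWord_add, pathWord_add]
    simpa [length_pathWord, length_cherryL, pathWord] using this
  obtain ⟨i, rfl⟩ := Nat.exists_eq_add_of_le (not_lt.1 h2)
  by_cases h3 : i < 4
  · rw [treeWord_eq, add_assoc]
    exact PumpRow₂.colorableOff_middle (h.2.2.1 i h3) k k'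
  obtain ⟨i, rfl⟩ := Nat.exists_eq_add_of_le (not_lt.1 h3)
  by_cases h4 : i < 4 * k' + r
  · obtain ⟨j, hj⟩ : ∃ j, 4 * k' + r = i + (1 + j) := ⟨4 * k' + r - i - 1, by omega⟩
    have hx' : Exits (cherryL ++ (pathWord (4 * k + r) ++ t)) := by
      have e : ∀ n, (cherryL ++ (pathWord (4 * k + r) ++ t)).length - (n + 1) -
          (cherryL ++ pathWord (4 * k + r)).length = t.length - (n + 1) := by
        intro n
        simp only [List.length_append]
        omega
      constructor
      · rw [← List.append_assoc, getD_append, if_neg (by simp; omega), List.append_assoc, e 0, hx.1]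
      · rw [← List.append_assoc, getD_append, if_neg (by simp; omega), List.append_assoc, e 1, hx.2]
    have := colorableOff_cut (true, false) (tL k i) (colorable_cherryR j) (by
      have := getD_append_pathWord hx' i
      simpa only [List.append_assoc] using this)
    rw [treeWord, hj, pathWord_add i, pathWord_add 1]
    simpa [length_pathWord, length_cherryL, ht, add_assoc, pathWord] using this
  obtain ⟨i, rfl⟩ := Nat.exists_eq_add_of_le (not_lt.1 h4)
  have := PumpRow₂.colorableOff_right (h.2.2.2 i (by omega)) k k'
  rw [← treeWord_eq, hy, length_cherryL] at this
  convert this using 1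
  ring

theorem pumpTable₂_left : PumpTable₂ 0 (middleL true)
    ([4, 3, 1], [2, 1, 3, 1], [2, 1, 1, 3], [1, 2, 1, 3], [2, 1, 1])
    [([0, 3, 1], [2, 1, 3, 1], [2, 1, 1, 3], [1, 2, 1, 3], [2, 1, 1]),
     ([3, 0, 1], [2, 1, 3, 1], [2, 1, 1, 3], [1, 2, 1, 3], [2, 1, 1]),
     ([1, 1, 0], [2, 1, 3, 1], [2, 1, 1, 3], [1, 2, 1, 3], [2, 1, 1])]
    [([1, 1, 3], [1, 2, 1, 3], [0, 1, 1, 2], [3, 1, 2, 1], [3, 1, 1]),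
     ([1, 1, 3], [1, 2, 1, 3], [1, 0, 2, 1], [3, 1, 2, 1], [3, 1, 1]),
     ([1, 1, 3], [1, 2, 1, 3], [1, 2, 0, 1], [3, 1, 2, 1], [3, 1, 1]),
     ([1, 1, 3], [1, 2, 1, 3], [2, 1, 1, 0], [1, 2, 1, 3], [2, 1, 1])]
    [([1, 1, 2], [3, 1, 2, 1], [3, 1, 1, 2], [1, 3, 1, 2], [0, 1, 1]),
     ([1, 1, 2], [3, 1, 2, 1], [3, 1, 1, 2], [1, 3, 1, 2], [1, 0, 3]),
     ([1, 1, 2], [3, 1, 2, 1], [3, 1, 1, 2], [1, 3, 1, 2], [1, 3, 0])] := by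
  decide +kernel

theorem pumpTable₂_right : PumpTable₂ 2 middleR
    ([4, 3, 1], [2, 1, 3, 1], [2, 1, 3, 1, 1, 2], [1, 3, 1, 2], [1, 3, 2, 1, 1])
    [([0, 3, 1], [2, 1, 3, 1], [2, 1, 3, 1, 1, 2], [1, 3, 1, 2], [1, 3, 2, 1, 1]),
     ([3, 0, 1], [2, 1, 3, 1], [2, 1, 3, 1, 1, 2], [1, 3, 1, 2], [1, 3, 2, 1, 1]),
     ([1, 1, 0], [2, 1, 3, 1], [2, 1, 3, 1, 1, 2], [1, 3, 1, 2], [1, 3, 2, 1, 1])]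
    [([1, 1, 3], [1, 2, 1, 3], [1, 2, 0, 1, 1, 2], [1, 3, 1, 2], [1, 3, 2, 1, 1]),
     ([1, 1, 3], [1, 2, 1, 3], [1, 2, 1, 0, 3, 1], [2, 1, 3, 1], [2, 1, 3, 1, 1]),
     ([1, 1, 3], [1, 2, 1, 3], [1, 2, 1, 3, 0, 1], [2, 1, 3, 1], [2, 1, 3, 1, 1]),
     ([1, 1, 2], [1, 3, 1, 2], [1, 3, 2, 1, 1, 0], [2, 1, 3, 1], [2, 1, 3, 1, 1])]
    [([1, 1, 2], [3, 1, 2, 1], [3, 1, 2, 1, 1, 3], [1, 2, 1, 3], [1, 2, 0, 1, 1]),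
     ([1, 1, 2], [3, 1, 2, 1], [3, 1, 2, 1, 1, 3], [1, 2, 1, 3], [1, 2, 1, 0, 3]),
     ([1, 1, 2], [3, 1, 2, 1], [3, 1, 2, 1, 1, 3], [1, 2, 1, 3], [1, 2, 1, 3, 0])] := by
  decide +kernel

theorem colorableOff_tree_left (k k' : ℕ) :
    ∀ i < (treeWord (4 * k + 0) (4 * k' + 0) (middleL true)).length,
      ColorableOff (treeWord (4 * k + 0) (4 * k' + 0) (middleL true)) i :=
  pumpTable₂_left.colorableOff (by decide)
    (colorable_tree_left (x := [1, 1, 2]) (m := [3, 1, 2, 1]) (y := [3, 1, 1, 2])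
      (m' := [1, 3, 1, 2]) (by decide +kernel))
    (colorable_tree_right (m := [2, 1, 3, 1]) (y := [2, 1, 1, 3]) (m' := [1, 2, 1, 3])
      (z := [2, 1, 1]) (by decide +kernel)) k k'

theorem colorableOff_tree_right (k k' : ℕ) :
    ∀ i < (treeWord (4 * k + 2) (4 * k' + 2) middleR).length,
      ColorableOff (treeWord (4 * k + 2) (4 * k' + 2) middleR) i :=
  pumpTable₂_right.colorableOff (by decide)
    (colorable_tree_left (x := [1, 1, 2]) (m := [3, 1, 2, 1]) (y := [3, 1, 2, 1, 1, 3])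
      (m' := [1, 2, 1, 3]) (by decide +kernel))
    (colorable_tree_right (m := [3, 1, 2, 1]) (y := [3, 1, 1, 2]) (m' := [1, 3, 1, 2])
      (z := [1, 3, 2, 1, 1]) (by decide +kernel)) k k'

theorem notColorable_tree (k k' : ℕ) :
    NotColorable (treeWord (4 * k + 0) (4 * k' + 0) (middleL false)) := by
  rw [treeWord_eq]
  exact (((((reaches_run cherryR).pump 3 (by decide +kernel) k').append (middleL false)).pump 3
    (by decide +kernel) k).append cherryL).notColorable (by decide +kernel)

theorem FamilyF4.critical {V : Type*} {G : SimpleGraph V} (hG : FamilyF4 G) :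
    IsKPackingVertexCritical 4 G := by
  obtain ⟨x, z, v, v₁, k, k', l, m, hx, hz, hv, hl, hm, hG⟩ := hG
  obtain rfl := eq_one_of_isNonPendant hx
  obtain rfl := eq_one_of_isNonPendant hz
  have hc : ∀ c, c = v ∨ c = v₁ := by omega
  -- the two numberings of the path `P₂`: `v₁` before `v`, and `v` before `v₁`
  let g : Fin 2 → ℕ := fun c => if c = v then 1 else 0
  let g' : Fin 2 → ℕ := fun c => if c = v then 0 else 1
  have hg : ∀ c, g c < 2 := fun c => by
    simp only [g]
    split_ifs <;> omega
  have hg' : ∀ c, g' c < 2 := fun c => by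
    simp only [g']
    split_ifs <;> omega
  have gv : g v = 1 := if_pos rfl
  have gv₁ : g v₁ = 0 := if_neg hv
  have gv' : g' v = 0 := if_pos rfl
  have gv₁' : g' v₁ = 1 := if_neg hv
  have gi : Function.Injective g := by
    intro c c' h
    rcases hc c with rfl | rfl <;> rcases hc c' with rfl | rfl <;> first | rfl | omega
  have gi' : Function.Injective g' := by
    intro c c' h
    rcases hc c with rfl | rfl <;> rcases hc c' with rfl | rfl <;> first | rfl | omega
  have gs : ∀ i < 2, ∃ c, g c = i := by
    intro i hi
    interval_cases i
    exacts [⟨v₁, gv₁⟩, ⟨v, gv⟩]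
  have low := treeF4_lower hv hl (m := m) gv gv₁
  have hl0 : l = 4 * k + 0 + 2 := hl
  have hm0 : m = 4 * k' + 0 := hm
  have lenL : ∀ c, (treeWord (4 * k + 0) (4 * k' + 0) (middleL c)).length = l + m + 8 := by
    intro c
    rw [length_treeWord (length_middleL c)]
    omega
  -- both the plain graph and the one with the edge to the first path
  have left : ∀ H : SimpleGraph ((((Fin 3 ⊕ Fin 2) ⊕ Fin 3) ⊕ Fin l) ⊕ Fin m),
      treeF4 1 v 1 l m ≤ H → (∀ p q, H.Adj p q →
        wadj (treeWord (4 * k + 0) (4 * k' + 0) (middleL true)) (treeIndex g p) (treeIndex g q)) →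
      Nonempty (G ≃g H) → IsKPackingVertexCritical 4 G := by
    rintro H hle hH ⟨f⟩
    refine critical_of_words f (w₀ := treeWord (4 * k + 0) (4 * k' + 0) (middleL false))
      (φ₀ := treeIndex g) (fun i hi => exists_treeIndex_eq gs (lenL false ▸ hi)) ?_
      (notColorable_tree k k') (treeIndex_injective hg gi)
      (fun p => lenL true ▸ treeIndex_lt hg p) hH (colorableOff_tree_left k k') ?_
    · rw [← hm0]
      exact fun p q h => hle (low p q h)
    · rw [treeWord_eq]
      exact PumpRow₂.colorableFour pumpTable₂_left.1 k k'
  have up := treeF4_upper_left hv (a := 4 * k + 0) hl0 (m := m) gv gv₁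
  have e : treeWord (4 * k + 0) m (middleL true) =
      treeWord (4 * k + 0) (4 * k' + 0) (middleL true) := by rw [hm0]
  rw [e] at up
  rcases hG with hG | ⟨j, hj, hG⟩ | ⟨j, hj, ⟨f⟩⟩
  · exact left _ le_rfl up.1 hG
  · refine left _ le_sup_left ?_ hG
    rintro p q (h | h)
    · exact up.1 p q h
    · have := up.2 j (by omega)
      rcases (edge_adj ..).1 h with ⟨⟨rfl, rfl⟩ | ⟨rfl, rfl⟩, -⟩
      · exact wadj_iff.2 (Or.inr this)
      · exact wadj_iff.2 (Or.inl this)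
  · obtain ⟨k', rfl⟩ : ∃ n, k' = n + 1 := ⟨k' - 1, by have := j.2; omega⟩
    have hm2 : m = 4 * k' + 2 + 2 := by omega
    have up := treeF4_upper_right hv (l := l) hm2 gv' gv₁'
    have e : treeWord l (4 * k' + 2) middleR = treeWord (4 * k + 2) (4 * k' + 2) middleR := by rw [hl]
    rw [e] at up
    refine critical_of_words f (w₀ := treeWord (4 * k + 0) (4 * (k' + 1) + 0) (middleL false))
      (w₁ := treeWord (4 * k + 2) (4 * k' + 2) middleR)
      (φ₀ := treeIndex g) (φ₁ := treeIndex g')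
      (fun i hi => exists_treeIndex_eq gs (lenL false ▸ hi)) ?_
      (notColorable_tree k (k' + 1)) (treeIndex_injective hg' gi') (fun p => ?_) ?_
      (colorableOff_tree_right k k') ?_
    · rw [← hm0]
      exact fun p q h => Or.inl (low p q h)
    · rw [length_treeWord length_middleR]
      have := treeIndex_lt hg' p
      omega
    · rintro p q (h | h)
      · exact up.1 p q h
      · have := up.2 j (by omega)
        rcases (edge_adj ..).1 h with ⟨⟨rfl, rfl⟩ | ⟨rfl, rfl⟩, -⟩
        · exact wadj_iff.2 (Or.inl this)
        · exact wadj_iff.2 (Or.inr this)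
    · rw [treeWord_eq]
      exact PumpRow₂.colorableFour pumpTable₂_right.1 k k'

end PackingColoring

theorem mainTheorem3 {V : Type*} (G : SimpleGraph V)
    (hG : PackingColoring.FamilyF1 G ∨ PackingColoring.FamilyF2 G ∨ PackingColoring.FamilyF3 G ∨
      PackingColoring.FamilyF4 G ∨ PackingColoring.FamilyF5 G) :
    PackingColoring.IsKPackingVertexCritical 4 G := by
  rcases hG with h | h | h | h | h
  exacts [h.critical, h.critical, h.critical, h.critical, h.critical]
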